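/- Let $\eta>0$, let $h:\mathbb R\to[0,\infty)$ be measurable with $h(t)=0$ for $t<0$ and $\int_{\mathbb R} h(t)\,dt<1$, and let $\Delta>0$. Let $N$ be a stationary Hawkes process on $\mathbb R$ with immigration intensity $\eta$ and reproduction function $h$: a simple, locally finite point process whose law is invariant under translations, with $m:=\mathbb E[N(0,1]]<\infty$, and which has, with respect to its internal history $\mathcal F_s=\sigma\big(N(B): B\subseteq(-\infty,s]\text{ Borel}\big)$, the conditional intensity $$\lambda(t)=\eta+\sum_{T_i<t}h(t-T_i),$$ where $\{T_i\}$ are the points of $N$; that is, $\mathbb E[N(s,t]\mid\mathcal F_s]=\mathbb E\big[\int_s^t\lambda(u)\,du\mid\mathcal F_s\big]$ for all $s\le t$. Write $\widetilde h(\omega)=\int_{\mathbb R}h(t)e^{-i\omega t}\,dt$ and $\mathrm{sinc}(x)=\sin(x)/x$ (with $\mathrm{sinc}(0)=1$), and put $$f_c(\omega)=m\,\Delta\,\mathrm{sinc}^2\!\Big(\frac\omega2\Big)\,\Big|1-\widetilde h\Big(\frac\omega\Delta\Big)\Big|^{-2},\qquad \omega\in\mathbb R .$$ Let $X_t=N\big((t\Delta,(t+1)\Delta]\big)$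 for $t\in\mathbb R$ be the bin-count process. Then $m=\eta\,\big(1-\int_{\mathbb R} h(t)\,dt\big)^{-1}$, and $f_c$ is the spectral density of $(X_t)_{t\in\mathbb R}$: this process is second-order stationary, its autocovariance $r_c(u)=\mathrm{Cov}(X_0,X_u)$ and $f_c$ are integrable on $\mathbb R$, and $$f_c(\omega)=\int_{\mathbb R} r_c(u)e^{-i\omega u}\,du,\qquad r_c(u)=\frac1{2\pi}\int_{\mathbb R} f_c(\omega)e^{i\omega u}\,d\omega\qquad(\omega,u\in\mathbb R).$$ Moreover, the bin-count sequence $(X_k)_{k\in\mathbb Z}$ has the aliased (periodised) spectral density $$f_d(\omega)=\sum_{k\in\mathbb Z}f_c(\omega+2k\pi),$$ the series converging for every $\omega\in\mathbb R$: the sequence is second-order stationary, $f_d$ is integrable on $[-\pi,\pi]$, and with $r_d(u)=\mathrm{Cov}(X_0,X_u)$, $u\in\mathbb Z$, $$f_d(\omega)=\sum_{u\in\mathbb Z}r_d(u)e^{-i\omega u}\quad(\omega\in\mathbb R),\qquad r_d(u)=\frac1{2\pi}\int_{-\pi}^{\pi}f_d(\omega)e^{i\omega u}\,d\omega\quad(u\in\mathbb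 Z),$$ the first series converging absolutely. -/

import Mathlib

open MeasureTheory ProbabilityTheory Set
open scoped ENNReal NNReal

noncomputable section

namespace HawkesSpectral

variable {Ω : Type*} [MeasurableSpace Ω]

/-! Point processes on the real line -/

/-- `ν` is a simple locally finite counting measure on `ℝ`: the counting measure of a set of points
(its atoms), finitely many of which lie in any bounded interval. -/
def IsSimpleCounting (ν : Measure ℝ) : Prop :=
  ∃ S : Set ℝ, (∀ a b : ℝ, (S ∩ Icc a b).Finite) ∧ ν = Measure.count.restrict S

/-- A simple locally finite point process on `ℝ`: a measurable map into the simple locally finite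
counting measures (the σ-algebra on measures is generated by the evaluations at Borel sets). -/
structure IsSimplePointProcess (N : Ω → Measure ℝ) : Prop where
  measurable : Measurable N
  counting : ∀ ω, IsSimpleCounting (N ω)

/-- Strict stationarity: the law of the process is invariant under all translations of the line. -/
def IsStationary (P : Measure Ω) (N : Ω → Measure ℝ) : Prop :=
  ∀ s : ℝ, P.map (fun ω => (N ω).map (fun x => x + s)) = P.map N

/-- The σ-algebra on `Ω` generated by the counts `N(B)`, for the Borel sets `B ⊆ A`. -/
abbrev sigmaOn (N : Ω → Measure ℝ) (A : Set ℝ) : MeasurableSpace Ω :=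
  ⨆ (B : Set ℝ) (_ : MeasurableSet B) (_ : B ⊆ A),
    MeasurableSpace.comap (fun ω => N ω B) inferInstance

/-- `lam` is a conditional intensity of `N` with respect to its internal history
`𝓕 s = σ(N(B) : B ⊆ (-∞, s])`, that is
`E[N(s, t] | 𝓕 s] = E[∫_s^t lam(u) du | 𝓕 s]` for all `s ≤ t`. -/
def HasConditionalIntensity (P : Measure Ω) (N : Ω → Measure ℝ) (lam : ℝ → Ω → ℝ≥0∞) : Prop :=
  ∀ s t : ℝ, s ≤ t → ∀ A : Set Ω, MeasurableSet[sigmaOn N (Iic s)] A →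
    ∫⁻ ω in A, N ω (Ioc s t) ∂P = ∫⁻ ω in A, (∫⁻ u in Ioc s t, lam u ω) ∂P

/-! Hawkes processes -/

/-- `η + ∑_{T_i < t} h (t - T_i)`, where the `T_i` are the atoms of `N`. -/
def hawkesIntensity (η : ℝ≥0) (h : ℝ → ℝ≥0) (N : Ω → Measure ℝ) (t : ℝ) (ω : Ω) : ℝ≥0∞ :=
  (η : ℝ≥0∞) + ∫⁻ u in Iio t, (h (t - u) : ℝ≥0∞) ∂(N ω)

/-- Stationary Hawkes process with immigration intensity `η` and reproduction function `h`
(as usual, a stationary process is one whose mean number of points per unit time is finite). -/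
structure IsStationaryHawkes (P : Measure Ω) (η : ℝ≥0) (h : ℝ → ℝ≥0) (N : Ω → Measure ℝ) :
    Prop where
  pointProcess : IsSimplePointProcess N
  stationary : IsStationary P N
  finite_mean : ∫⁻ ω, N ω (Ioc 0 1) ∂P ≠ ∞
  intensity : HasConditionalIntensity P N (hawkesIntensity η h N)

/-- `m = E[N(0, 1]]`. -/
def meanIntensity (P : Measure Ω) (N : Ω → Measure ℝ) : ℝ :=
  ∫ ω, (N ω).real (Ioc 0 1) ∂P

/-- The bin-count process `X_t = N(tΔ, (t+1)Δ]`. -/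
def binCount (N : Ω → Measure ℝ) (Δ : ℝ) (t : ℝ) (ω : Ω) : ℝ :=
  (N ω).real (Ioc (t * Δ) ((t + 1) * Δ))

/-- The bin-count sequence: the restriction of the bin-count process to `ℤ`. -/
def binCountSeq (N : Ω → Measure ℝ) (Δ : ℝ) (k : ℤ) (ω : Ω) : ℝ :=
  binCount N Δ (k : ℝ) ω

/-- Fourier transform `∫ φ(t) e^{-iωt} dt`. -/
def fourierTilde (φ : ℝ → ℝ) (ω : ℝ) : ℂ :=
  ∫ t : ℝ, (φ t : ℂ) * Complex.exp (-(Complex.I * ω * t))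

/-- `f_c(ω) = m Δ sinc²(ω/2) |1 - h̃(ω/Δ)|⁻²`, with `sinc x = sin x / x`. -/
def fc (m Δ : ℝ) (h : ℝ → ℝ≥0) (ω : ℝ) : ℝ :=
  m * Δ * Real.sinc (ω / 2) ^ 2 * (‖1 - fourierTilde (fun t => (h t : ℝ)) (ω / Δ)‖ ^ 2)⁻¹

/-! Second-order processes and spectral densities -/

/-- Weak (second-order) stationarity of a real process indexed by `T` (here `ℤ` or `ℝ`). -/
structure IsWeaklyStationary {T : Type*} [AddGroup T] (P : Measure Ω) (X : T → Ω → ℝ) : Prop where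
  memLp : ∀ t, MemLp (X t) 2 P
  mean : ∀ t, ∫ ω, X t ω ∂P = ∫ ω, X 0 ω ∂P
  cov : ∀ s u, cov[X s, X (s + u); P] = cov[X 0, X u; P]

/-- Autocovariance function `r(u) = Cov(X_0, X_u)`. -/
def autocov {T : Type*} [AddGroup T] (P : Measure Ω) (X : T → Ω → ℝ) (u : T) : ℝ :=
  cov[X 0, X u; P]

/-- `f` is the spectral density of the continuous-time process `X`: it forms a Fourier pair with the
autocovariance function. -/
structure IsSpectralDensityCont (P : Measure Ω) (X : ℝ → Ω → ℝ) (f : ℝ → ℝ) : Prop where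
  stationary : IsWeaklyStationary P X
  integrable_autocov : Integrable (autocov P X)
  fourier : ∀ ω : ℝ,
    (f ω : ℂ) = ∫ u : ℝ, (autocov P X u : ℂ) * Complex.exp (-(Complex.I * ω * u))
  integrable : Integrable f
  inversion : ∀ u : ℝ, (autocov P X u : ℂ) =
    (1 / (2 * Real.pi) : ℂ) * ∫ ω : ℝ, (f ω : ℂ) * Complex.exp (Complex.I * ω * u)

/-- `f` is the spectral density of the discrete-time process `X`: it forms a Fourier pair with the
autocovariance function. -/
structure IsSpectralDensityDisc (P : Measure Ω) (X : ℤ → Ω → ℝ) (f : ℝ → ℝ) : Prop where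
  stationary : IsWeaklyStationary P X
  fourier : ∀ ω : ℝ,
    HasSum (fun u : ℤ => (autocov P X u : ℂ) * Complex.exp (-(Complex.I * ω * u))) (f ω : ℂ)
  integrable : IntervalIntegrable f volume (-Real.pi) Real.pi
  inversion : ∀ u : ℤ, (autocov P X u : ℂ) =
    (1 / (2 * Real.pi) : ℂ) *
      ∫ ω in (-Real.pi)..Real.pi, (f ω : ℂ) * Complex.exp (Complex.I * ω * u)

end HawkesSpectral

end

/-!
The counts of a stationary Hawkes process are a moving average of its compensated process. Let
`R = ∑ₙ (h dt)^{*n}` be the resolvent measure of `h` (`resolvent`), which is finite because `∫ h < 1`,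
and let `f(u) = R (a - u, b - u]` be the response function of the interval `(a, b]` (`response`).
The backward renewal equation `f = 1_{(a, b]} + ∫ h(w) f(· + w) dw` says that, almost surely,

  `N(a, b] = η ∫ f(u) du + ∫ f(u) (N(du) - λ(u) du)`

(`IsStationaryHawkes.ae_count_eq`). So the mean of `N(a, b]` is the first term, and everything about
second moments is contained in the isometry

  `E [(∫ g (dN - λ du)) ^ 2] = E [∫ g ^ 2 dN]`

for bounded predictable `g` with `E [∫ |g| dN] < ∞` (`HasPredictableIntensity.integral_sq_compIntegral`).
The defining property of the intensity extends from predictable rectangles to all predictable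
integrands by a monotone class argument, so compensated integrals are centred. Integration by parts
on each path writes the square of a compensated integral as `∫ g ^ 2 dN` plus twice a compensated
integral, that of `g` times the running integral over the strict past. If the variation of the past
is bounded on the support of `g`, that integrand is integrable, and its compensated integral has
mean zero; the general case follows by truncating where the variation of the past is large. This
needs measurability of integrals over the past with respect to the predictable σ-algebra, which is
obtained by treating the past as an s-finite kernel (`IsAdaptedMeasure.pastKernel`). No a priori
square integrability of the counts is used: it is a consequence.

By stationarity `E [∫ φ dN] = m ∫ φ`, so the covariance of the counts of two intervals is `m` times
the integral of the product of their response functions. For the bins, the autocovariance at lag `u`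
is `m` times the autocorrelation at `u Δ` of the response function `f` of `(0, Δ]`, and its Fourier
transform is `(m / Δ) |f̂(ω / Δ)|²`. The renewal equation gives `f̂ = φ̂ / conj (1 - h̃)`, where `φ` is
the indicator of `(0, Δ]`, and this is `f_c` (`IsStationaryHawkes.fc_eq_integral`).

The autocovariance is integrable, and continuous since `f` is a difference of monotone functions;
`f_c` is continuous and `O(1 / (1 + ω²))`, so Fourier inversion holds. The autocovariance is summable
over `ℤ`, because the translates of `(0, Δ]` by multiples of `Δ` partition the line
(`summable_autocorrelation`), so Poisson summation applied to `f_c` (`hasSum_periodisation`) gives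
the aliased density, and its Fourier coefficients are computed term by term.
-/

noncomputable section

namespace HawkesSpectral

/-! ### Kernels with locally finite values -/

section SFiniteKernel

variable {α β : Type*} [MeasurableSpace α] [MeasurableSpace β]

lemma isSFiniteKernel_of_isFiniteMeasure (κ : Kernel α β) (hκ : ∀ a, κ a univ ≠ ∞) :
    IsSFiniteKernel κ := by
  have hm : Measurable fun a => κ a univ := κ.measurable_coe .univ
  let S : ℕ → Set α := fun n => {a | (n : ℝ≥0∞) ≤ κ a univ ∧ κ a univ < n + 1}
  have hS : ∀ n, MeasurableSet (S n) := fun n =>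
    (measurableSet_le measurable_const hm).inter (measurableSet_lt hm measurable_const)
  classical
  let κ' : ℕ → Kernel α β := fun n => Kernel.piecewise (hS n) κ 0
  have hfin : ∀ n, IsFiniteKernel (κ' n) := by
    intro n
    refine ⟨⟨n + 1, by finiteness, fun a => ?_⟩⟩
    simp only [κ', Kernel.piecewise_apply]
    split_ifs with h
    · exact h.2.le
    · simp
  have hsum : κ = Kernel.sum κ' := by
    ext a s hs
    rw [Kernel.sum_apply' _ _ hs]
    set n := ⌊(κ a univ).toReal⌋₊
    have hn : a ∈ S n := by
      have h1 : (n : ℝ) ≤ (κ a univ).toReal := Nat.floor_le ENNReal.toReal_nonneg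
      have h2 : (κ a univ).toReal < n + 1 := Nat.lt_floor_add_one _
      constructor
      · rw [← ENNReal.ofReal_toReal (hκ a), ← ENNReal.ofReal_natCast]
        exact ENNReal.ofReal_le_ofReal h1
      · rw [← ENNReal.ofReal_toReal (hκ a), ← ENNReal.ofReal_natCast, ← ENNReal.ofReal_one,
          ← ENNReal.ofReal_add (by positivity) zero_le_one]
        exact (ENNReal.ofReal_lt_ofReal_iff (by positivity)).2 h2
    rw [tsum_eq_single n]
    · simp [κ', Kernel.piecewise_apply, hn]
    · intro k hk
      have : a ∉ S k := by
        rintro ⟨h1, h2⟩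
        have h3 : (n : ℝ≥0∞) < k + 1 := hn.1.trans_lt h2
        have h4 : (k : ℝ≥0∞) < n + 1 := h1.trans_lt hn.2
        norm_cast at h3 h4
        omega
      simp [κ', Kernel.piecewise_apply, this]
  rw [hsum]
  infer_instance

/-- A kernel is s-finite as soon as each of its values is finite on each set of a countable
measurable partition; no uniformity in the parameter is needed. -/
lemma isSFiniteKernel_of_partition {ι : Type*} [Countable ι] (κ : Kernel α β) (B : ι → Set β)
    (hB : ∀ i, MeasurableSet (B i)) (hd : Pairwise (Function.onFun Disjoint B))
    (hU : ⋃ i, B i = univ) (hκ : ∀ a i, κ a (B i) ≠ ∞) : IsSFiniteKernel κ := by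
  have hsum : κ = Kernel.sum fun i => κ.restrict (hB i) := by
    ext a s hs
    rw [Kernel.sum_apply' _ _ hs]
    simp only [Kernel.restrict_apply, Measure.restrict_apply hs]
    rw [← measure_iUnion (fun i j hij => (hd hij).mono inter_subset_right inter_subset_right)
      fun i => hs.inter (hB i), ← inter_iUnion, hU, inter_univ]
  rw [hsum]
  have := fun i => isSFiniteKernel_of_isFiniteMeasure (κ.restrict (hB i))
    (fun a => by simpa [Kernel.restrict_apply] using hκ a i)
  exact inferInstance

end SFiniteKernel

/-! ### The predictable σ-algebra -/

section Predictable

variable {Ω : Type*} {mΩ : MeasurableSpace Ω}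

/-- The space `Ω × ℝ`, to be equipped with the predictable σ-algebra of the filtration `𝓕` in place
of the product σ-algebra. -/
def PredSpace (_ : Filtration ℝ mΩ) : Type _ := Ω × ℝ

/-- The predictable rectangles `A × (a, b]` with `A ∈ 𝓕 a`. -/
def predRect (𝓕 : Filtration ℝ mΩ) : Set (Set (PredSpace 𝓕)) :=
  {S | ∃ (A : Set Ω) (a b : ℝ), MeasurableSet[𝓕 a] A ∧ S = {x | x.1 ∈ A ∧ x.2 ∈ Ioc a b}}

instance (𝓕 : Filtration ℝ mΩ) : MeasurableSpace (PredSpace 𝓕) :=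
  MeasurableSpace.generateFrom (predRect 𝓕)

/-- The identity, as a map from `Ω × ℝ` with the product σ-algebra to `PredSpace 𝓕`. -/
def toPred (𝓕 : Filtration ℝ mΩ) (p : Ω × ℝ) : PredSpace 𝓕 := p

variable {𝓕 : Filtration ℝ mΩ}

lemma measurable_toPred : Measurable (toPred 𝓕) := by
  refine measurable_generateFrom ?_
  rintro _ ⟨A, a, b, hA, rfl⟩
  exact (𝓕.le a A hA).prod measurableSet_Ioc

lemma measurable_toPred_mk (ω : Ω) : Measurable fun u : ℝ => toPred 𝓕 (ω, u) :=
  measurable_toPred.comp measurable_prodMk_left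

lemma isPiSystem_predRect : IsPiSystem (predRect 𝓕) := by
  rintro _ ⟨A, a, b, hA, rfl⟩ _ ⟨A', a', b', hA', rfl⟩ -
  refine ⟨A ∩ A', max a a', min b b', ?_, ?_⟩
  · exact (𝓕.mono (le_max_left a a') A hA).inter (𝓕.mono (le_max_right a a') A' hA')
  · rw [← Ioc_inter_Ioc]
    ext x
    exact and_and_and_comm

lemma measurableSet_predRect {A : Set Ω} {a : ℝ} (b : ℝ) (hA : MeasurableSet[𝓕 a] A) :
    MeasurableSet {x : PredSpace 𝓕 | x.1 ∈ A ∧ x.2 ∈ Ioc a b} :=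
  MeasurableSpace.measurableSet_generateFrom ⟨A, a, b, hA, rfl⟩

lemma measurableSet_pred_Ioi {A : Set Ω} {a : ℝ} (hA : MeasurableSet[𝓕 a] A) :
    MeasurableSet {x : PredSpace 𝓕 | x.1 ∈ A ∧ a < x.2} := by
  have : {x : PredSpace 𝓕 | x.1 ∈ A ∧ a < x.2} =
      ⋃ n : ℕ, {x : PredSpace 𝓕 | x.1 ∈ A ∧ x.2 ∈ Ioc a n} := by
    ext x
    simp only [mem_ofPred_eq, mem_Ioc, mem_iUnion]
    constructor
    · rintro ⟨h1, h2⟩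
      obtain ⟨n, hn⟩ := exists_nat_ge x.2
      exact ⟨n, h1, h2, hn⟩
    · rintro ⟨n, h1, h2, -⟩
      exact ⟨h1, h2⟩
  rw [this]
  exact .iUnion fun n => measurableSet_predRect _ hA

lemma measurable_pred_snd : Measurable fun x : PredSpace 𝓕 => x.2 := by
  refine measurable_of_Ioi fun a => ?_
  have := measurableSet_pred_Ioi (𝓕 := 𝓕) (A := univ) (a := a) .univ
  simpa only [mem_univ, true_and] using! this

/-- A random variable known at time `q`, switched on after time `q`, is predictable. -/
lemma measurable_pred_indicator {q : ℝ} {X : Ω → ℝ≥0∞} (hX : Measurable[𝓕 q] X) :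
    Measurable fun x : PredSpace 𝓕 => if q < x.2 then X x.1 else 0 := by
  refine measurable_of_Ioi fun c => ?_
  have : (fun x : PredSpace 𝓕 => if q < x.2 then X x.1 else 0) ⁻¹' Ioi c =
      {x : PredSpace 𝓕 | x.1 ∈ X ⁻¹' Ioi c ∧ q < x.2} := by
    ext x
    simp only [mem_preimage, mem_Ioi, mem_ofPred_eq]
    split_ifs with h <;> simp [h]
  rw [this]
  exact measurableSet_pred_Ioi (hX measurableSet_Ioi)

/-- A random measure on the line, finite on bounded intervals, whose mass on `(a, b]` is known at
time `b`. -/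
structure IsAdaptedMeasure (𝓕 : Filtration ℝ mΩ) (κ : Ω → Measure ℝ) : Prop where
  finite : ∀ ω a b, κ ω (Ioc a b) ≠ ∞
  adapted : ∀ a b, Measurable[𝓕 b] fun ω => κ ω (Ioc a b)

variable {κ : Ω → Measure ℝ}

lemma IsAdaptedMeasure.measurable_past (hκ : IsAdaptedMeasure 𝓕 κ) {A : Set Ω} {a : ℝ}
    (hA : MeasurableSet[𝓕 a] A) (b : ℝ) :
    Measurable fun x : PredSpace 𝓕 =>
      A.indicator (fun _ => κ x.1 (Ioc a b ∩ Iio x.2)) x.1 := by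
  have key : (fun x : PredSpace 𝓕 => A.indicator (fun _ => κ x.1 (Ioc a b ∩ Iio x.2)) x.1) =
      fun x => ⨆ q : ℚ, if (q : ℝ) < x.2 then A.indicator (fun ω => κ ω (Ioc a (min b q))) x.1
        else 0 := by
    funext x
    by_cases hx : x.1 ∈ A
    · simp only [indicator_of_mem hx]
      have hU : Ioc a b ∩ Iio x.2 = ⋃ q : {q : ℚ // (q : ℝ) < x.2}, Ioc a (min b q) := by
        ext u
        simp only [mem_inter_iff, mem_Ioc, mem_Iio, mem_iUnion, le_min_iff]
        constructor
        · rintro ⟨⟨h1, h2⟩, h3⟩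
          obtain ⟨q, hq1, hq2⟩ := exists_rat_btwn h3
          exact ⟨⟨q, hq2⟩, h1, h2, hq1.le⟩
        · rintro ⟨⟨q, hq⟩, h1, h2, h3⟩
          exact ⟨⟨h1, h2⟩, h3.trans_lt hq⟩
      rw [hU, Directed.measure_iUnion, iSup_subtype]
      · refine iSup_congr fun q => ?_
        split_ifs with h <;> simp [h]
      · refine directed_of_isDirected_le fun q q' hqq => ?_
        have : ((q : ℚ) : ℝ) ≤ ((q' : ℚ) : ℝ) := by exact_mod_cast hqq
        exact Ioc_subset_Ioc_right (min_le_min_left b this)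
    · simp [indicator_of_notMem hx]
  rw [key]
  refine Measurable.iSup fun q => ?_
  by_cases hq : a ≤ q
  · refine measurable_pred_indicator ?_
    have h1 : Measurable[𝓕 q] fun ω => κ ω (Ioc a (min b q)) :=
      (hκ.adapted a (min b q)).mono (𝓕.mono (min_le_right b (q : ℝ))) le_rfl
    exact h1.indicator (𝓕.mono hq A hA)
  · have : ∀ ω, κ ω (Ioc a (min b q)) = 0 := by
      intro ω
      rw [Ioc_eq_empty, measure_empty]
      push Not at hq ⊢
      exact (min_le_right _ _).trans hq.le
    simp [this]

/-- The restriction of `κ ω` to the strict past of `t`, at `x = (ω, t)`, transported to the fibre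
`{ω} × ℝ`, so that integrands depending on `ω` can be integrated against it. -/
def pastMeasure (𝓕 : Filtration ℝ mΩ) (κ : Ω → Measure ℝ) (x : PredSpace 𝓕) :
    Measure (PredSpace 𝓕) :=
  ((κ x.1).restrict (Iio x.2)).map fun u => toPred 𝓕 (x.1, u)

/-- The strips `Ω × (n, n + 1]`. -/
def predStrip (𝓕 : Filtration ℝ mΩ) (n : ℤ) : Set (PredSpace 𝓕) :=
  {x | x.2 ∈ Ioc (n : ℝ) (n + 1)}

lemma measurableSet_predStrip (n : ℤ) : MeasurableSet (predStrip 𝓕 n) :=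
  measurable_pred_snd measurableSet_Ioc

lemma pairwise_disjoint_predStrip : Pairwise (Function.onFun Disjoint (predStrip 𝓕)) := by
  intro m n hmn
  have := pairwise_disjoint_Ioc_intCast ℝ hmn
  exact Disjoint.preimage (fun x : PredSpace 𝓕 => x.2) this

lemma iUnion_predStrip : ⋃ n, predStrip 𝓕 n = univ := by
  ext x
  have : x.2 ∈ ⋃ n : ℤ, Ioc (n : ℝ) (n + 1) := by rw [iUnion_Ioc_intCast]; trivial
  simpa [predStrip] using this

lemma pastMeasure_apply (x : PredSpace 𝓕) {S : Set (PredSpace 𝓕)} (hS : MeasurableSet S) :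
    pastMeasure 𝓕 κ x S = κ x.1 ({u | toPred 𝓕 (x.1, u) ∈ S} ∩ Iio x.2) := by
  rw [pastMeasure, Measure.map_apply (measurable_toPred_mk _) hS,
    Measure.restrict_apply (measurable_toPred_mk _ hS)]
  rfl

lemma IsAdaptedMeasure.pastMeasure_predStrip_ne_top (hκ : IsAdaptedMeasure 𝓕 κ) (x : PredSpace 𝓕)
    (n : ℤ) : pastMeasure 𝓕 κ x (predStrip 𝓕 n) ≠ ∞ := by
  rw [pastMeasure_apply _ (measurableSet_predStrip n)]
  exact measure_ne_top_of_subset inter_subset_left (hκ.finite x.1 n (n + 1))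

lemma IsAdaptedMeasure.measurable_pastMeasure (hκ : IsAdaptedMeasure 𝓕 κ) :
    Measurable (pastMeasure 𝓕 κ) := by
  have hn : ∀ n : ℤ, Measurable fun x => (pastMeasure 𝓕 κ x).restrict (predStrip 𝓕 n) := by
    intro n
    have : ∀ x, IsFiniteMeasure ((pastMeasure 𝓕 κ x).restrict (predStrip 𝓕 n)) := fun x =>
      ⟨by simpa using (hκ.pastMeasure_predStrip_ne_top x n).lt_top⟩
    refine Measurable.measure_of_isPiSystem (S := predRect 𝓕) rfl isPiSystem_predRect ?_ ?_
    · rintro _ ⟨A, a, b, hA, rfl⟩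
      have hAm := 𝓕.mono (le_max_left a (n : ℝ)) A hA
      convert hκ.measurable_past hAm (min b (n + 1)) using 2 with x
      rw [Measure.restrict_apply (measurableSet_predRect b hA), pastMeasure_apply _
        ((measurableSet_predRect b hA).inter (measurableSet_predStrip n))]
      by_cases hx : x.1 ∈ A
      · rw [indicator_of_mem hx, ← Ioc_inter_Ioc]
        congr 2
        ext u
        change ((x.1 ∈ A ∧ u ∈ Ioc a b) ∧ u ∈ Ioc (n : ℝ) (n + 1)) ↔ _
        simp [hx]
      · rw [indicator_of_notMem hx]
        convert measure_empty (μ := κ x.1) using 2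
        ext u
        simp only [mem_inter_iff, mem_empty_iff_false, iff_false]
        rintro ⟨⟨h, -⟩, -⟩
        exact hx h.1
    · convert hκ.measurable_past (A := univ) (a := n) .univ (n + 1) using 2 with x
      rw [Measure.restrict_apply .univ, univ_inter, pastMeasure_apply _ (measurableSet_predStrip n)]
      rw [indicator_of_mem (mem_univ _)]
      rfl
  refine Measure.measurable_of_measurable_coe _ fun S hS => ?_
  have : (fun x => pastMeasure 𝓕 κ x S) =
      fun x => ∑' n : ℤ, (pastMeasure 𝓕 κ x).restrict (predStrip 𝓕 n) S := by
    funext x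
    simp only [Measure.restrict_apply hS]
    rw [← measure_iUnion (fun i j hij => (pairwise_disjoint_predStrip hij).mono
      inter_subset_right inter_subset_right) fun i => hS.inter (measurableSet_predStrip i),
      ← inter_iUnion, iUnion_predStrip, inter_univ]
  rw [this]
  exact Measurable.tsum fun n => Measure.measurable_coe hS |>.comp (hn n)

/-- `pastMeasure` as a kernel from the predictable space to itself. -/
def IsAdaptedMeasure.pastKernel (hκ : IsAdaptedMeasure 𝓕 κ) :
    Kernel (PredSpace 𝓕) (PredSpace 𝓕) :=
  ⟨pastMeasure 𝓕 κ, hκ.measurable_pastMeasure⟩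

instance (hκ : IsAdaptedMeasure 𝓕 κ) : IsSFiniteKernel hκ.pastKernel :=
  isSFiniteKernel_of_partition _ (predStrip 𝓕) measurableSet_predStrip pairwise_disjoint_predStrip
    iUnion_predStrip fun x n => hκ.pastMeasure_predStrip_ne_top x n

/-- Integrals over the strict past, of integrands that may depend on the present time too, are
predictable. -/
lemma IsAdaptedMeasure.measurable_lintegral_past (hκ : IsAdaptedMeasure 𝓕 κ)
    {G : PredSpace 𝓕 → PredSpace 𝓕 → ℝ≥0∞} (hG : Measurable (Function.uncurry G)) :
    Measurable fun x : PredSpace 𝓕 =>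
      ∫⁻ u in Iio x.2, G x (toPred 𝓕 (x.1, u)) ∂κ x.1 := by
  convert hG.lintegral_kernel_prod_right (κ := hκ.pastKernel) using 2 with x
  have : hκ.pastKernel x = pastMeasure 𝓕 κ x := rfl
  rw [this, pastMeasure, lintegral_map _ (measurable_toPred_mk _)]
  exact hG.comp measurable_prodMk_left

lemma IsAdaptedMeasure.measurable_integral_past (hκ : IsAdaptedMeasure 𝓕 κ)
    {g : PredSpace 𝓕 → ℝ} (hg : Measurable g) :
    Measurable fun x : PredSpace 𝓕 => ∫ u in Iio x.2, g (toPred 𝓕 (x.1, u)) ∂κ x.1 := by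
  convert (hg.stronglyMeasurable.integral_kernel (κ := hκ.pastKernel)).measurable using 2 with x
  have : hκ.pastKernel x = pastMeasure 𝓕 κ x := rfl
  rw [this, pastMeasure, integral_map (measurable_toPred_mk _).aemeasurable
    hg.aestronglyMeasurable]

lemma isAdaptedMeasure_volume : IsAdaptedMeasure 𝓕 fun _ => (volume : Measure ℝ) :=
  ⟨fun _ _ _ => by simp, fun _ _ => measurable_const⟩

end Predictable

/-! ### Integration by parts for integrals on the line -/

section ByParts

variable {μ ν : Measure ℝ} [SFinite ν] {g k : ℝ → ℝ}

lemma integrable_mul_integral_Iio (hg : Integrable g μ) (hk : Integrable k ν) :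
    Integrable (fun s => g s * ∫ u in Iio s, k u ∂ν) μ := by
  have h1 : Integrable (fun z : ℝ × ℝ => g z.1 * k z.2) (μ.prod ν) := hg.mul_prod hk
  have h2 := (h1.indicator (measurableSet_lt measurable_snd measurable_fst)).integral_prod_left
  refine h2.congr (.of_forall fun s => ?_)
  simp only
  rw [← integral_const_mul, ← integral_indicator measurableSet_Iio]
  rfl

/-- A product of two integrals, split over the two open half-planes and the diagonal of the plane. -/
lemma integral_mul_integral_eq [SFinite μ] (hg : Integrable g μ) (hk : Integrable k ν) :
    (∫ s, g s ∂μ) * ∫ s, k s ∂ν =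
      (∫ s, g s * ∫ u in Iio s, k u ∂ν ∂μ) + (∫ s, k s * ∫ u in Iio s, g u ∂μ ∂ν) +
        ∫ s, g s * (k s * ν.real {s}) ∂μ := by
  have h1 : Integrable (fun z : ℝ × ℝ => g z.1 * k z.2) (μ.prod ν) := hg.mul_prod hk
  have m1 : MeasurableSet {z : ℝ × ℝ | z.2 < z.1} := measurableSet_lt measurable_snd measurable_fst
  have m2 : MeasurableSet {z : ℝ × ℝ | z.1 < z.2} := measurableSet_lt measurable_fst measurable_snd
  have m3 : MeasurableSet {z : ℝ × ℝ | z.1 = z.2} := measurableSet_eq_fun measurable_fst measurable_snd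
  have hsplit : (fun z : ℝ × ℝ => g z.1 * k z.2) = fun z =>
      ({z : ℝ × ℝ | z.2 < z.1}.indicator (fun z : ℝ × ℝ => g z.1 * k z.2) z +
      {z : ℝ × ℝ | z.1 < z.2}.indicator (fun z : ℝ × ℝ => g z.1 * k z.2) z) +
      {z : ℝ × ℝ | z.1 = z.2}.indicator (fun z : ℝ × ℝ => g z.1 * k z.2) z := by
    funext ⟨x, y⟩
    rcases lt_trichotomy x y with h | h | h
    · simp [indicator, h, h.not_gt, h.ne]
    · simp [indicator, h]
    · simp [indicator, h, h.not_gt, h.ne']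
  rw [← integral_prod_mul, hsplit, integral_add (by exact (h1.indicator m1).add (h1.indicator m2))
    (h1.indicator m3), integral_add (h1.indicator m1) (h1.indicator m2),
    integral_prod _ (h1.indicator m1), integral_prod_symm _ (h1.indicator m2),
    integral_prod _ (h1.indicator m3)]
  congr 1
  · congr 1
    · refine integral_congr_ae (.of_forall fun s => ?_)
      simp only
      rw [← integral_const_mul, ← integral_indicator measurableSet_Iio]
      rfl
    · refine integral_congr_ae (.of_forall fun s => ?_)
      simp only
      rw [← integral_const_mul, ← integral_indicator measurableSet_Iio]
      refine integral_congr_ae (.of_forall fun u => ?_)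
      simp only [indicator, mem_ofPred_eq, mem_Iio, mul_comm]
  · refine integral_congr_ae (.of_forall fun s => ?_)
    have : (fun y => {z : ℝ × ℝ | z.1 = z.2}.indicator (fun z : ℝ × ℝ => g z.1 * k z.2) (s, y)) =
        ({s} : Set ℝ).indicator fun y => g s * k y := by
      funext y
      simp only [indicator, mem_ofPred_eq, mem_singleton_iff, eq_comm]
    simp only [this]
    rw [integral_indicator (measurableSet_singleton s)]
    by_cases hs : ν {s} = ∞
    · have : ∀ᵐ y ∂ν.restrict {s}, g s * k y = g s * k s := by
        filter_upwards [ae_restrict_mem (measurableSet_singleton s)] with y hy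
        rw [mem_singleton_iff.1 hy]
      rw [integral_congr_ae this, integral_const]
      simp [Measure.real, hs]
    · rw [integral_singleton, smul_eq_mul]
      ring

/-- The square of the total mass `∫ g dμ - ∫ k dν`, for simple `μ` and diffuse `ν`: twice the
integral of its running value in the past, plus the sum of the squares of its jumps. -/
lemma sq_integral_sub_integral [SFinite μ] [NullSingletonClass ν]
    (hμ : ∀ᵐ s ∂μ, μ {s} = 1) (hg : Integrable g μ)
    (hk : Integrable k ν) :
    ((∫ s, g s ∂μ) - ∫ s, k s ∂ν) ^ 2 =
      2 * ((∫ s, g s * ((∫ u in Iio s, g u ∂μ) - ∫ u in Iio s, k u ∂ν) ∂μ) -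
        ∫ s, k s * ((∫ u in Iio s, g u ∂μ) - ∫ u in Iio s, k u ∂ν) ∂ν) + ∫ s, g s ^ 2 ∂μ := by
  have e1 := integral_mul_integral_eq hg hg
  have e2 := integral_mul_integral_eq hk hk
  have e3 := integral_mul_integral_eq hg hk
  have d1 : ∫ s, g s * (g s * μ.real {s}) ∂μ = ∫ s, g s ^ 2 ∂μ := by
    refine integral_congr_ae ?_
    filter_upwards [hμ] with s hs
    simp [Measure.real, hs, sq]
  simp only [Measure.real, measure_singleton, ENNReal.toReal_zero, mul_zero, integral_zero,
    add_zero] at e2 e3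
  rw [d1] at e1
  simp only [mul_sub]
  rw [integral_sub (integrable_mul_integral_Iio hg hg) (integrable_mul_integral_Iio hg hk),
    integral_sub (integrable_mul_integral_Iio hk hg) (integrable_mul_integral_Iio hk hk)]
  linear_combination e1 + e2 - 2 * e3

end ByParts

lemma integrable_integral_of_integrable_compProd {α β : Type*} [MeasurableSpace α]
    [MeasurableSpace β] {μ : Measure α} [SFinite μ] {κ : Kernel α β} [IsSFiniteKernel κ]
    {f : α × β → ℝ} (hf : Integrable f (μ ⊗ₘ κ)) : Integrable (fun a => ∫ b, f (a, b) ∂κ a) μ := by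
  have := MeasureTheory.Integrable.integral_compProd (κ := Kernel.const Unit μ)
    (η := Kernel.prodMkLeft Unit κ) (a := ()) hf
  simpa using this

/-! ### Compensated integrals of predictable integrands -/

section Compensated

variable {Ω : Type*} {mΩ : MeasurableSpace Ω}

/-- The random measure `κ` is a simple locally finite point process with integrable counts, adapted
to `𝓕`, and `lam` is a predictable conditional intensity of it. -/
structure HasPredictableIntensity (P : Measure Ω) (𝓕 : Filtration ℝ mΩ) (κ : Kernel Ω ℝ)
    (lam : PredSpace 𝓕 → ℝ≥0∞) : Prop where
  adapted : IsAdaptedMeasure 𝓕 κ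
  measurable : Measurable lam
  compensator : ∀ s t : ℝ, ∀ A : Set Ω, MeasurableSet[𝓕 s] A →
    ∫⁻ ω in A, κ ω (Ioc s t) ∂P = ∫⁻ ω in A, (∫⁻ u in Ioc s t, lam (toPred 𝓕 (ω, u))) ∂P
  finite_mean : ∀ a b, ∫⁻ ω, κ ω (Ioc a b) ∂P ≠ ∞
  simple : ∀ ω, ∀ᵐ s ∂κ ω, κ ω {s} = 1

/-- The compensated integral `∫ g dκ - ∫ g(u) lam(u) du`. -/
def compIntegral {𝓕 : Filtration ℝ mΩ} (κ : Kernel Ω ℝ) (lam : PredSpace 𝓕 → ℝ≥0∞)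
    (g : PredSpace 𝓕 → ℝ) (ω : Ω) : ℝ :=
  (∫ u, g (toPred 𝓕 (ω, u)) ∂κ ω) -
    ∫ u, g (toPred 𝓕 (ω, u)) * (lam (toPred 𝓕 (ω, u))).toReal

variable {P : Measure Ω} {𝓕 : Filtration ℝ mΩ} {κ : Kernel Ω ℝ}
  {lam : PredSpace 𝓕 → ℝ≥0∞}

namespace HasPredictableIntensity

lemma isSFiniteKernel (H : HasPredictableIntensity P 𝓕 κ lam) : IsSFiniteKernel κ :=
  isSFiniteKernel_of_partition κ (fun n : ℤ => Ioc (n : ℝ) (n + 1)) (fun _ => measurableSet_Ioc)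
    (pairwise_disjoint_Ioc_intCast ℝ) (iUnion_Ioc_intCast ℝ) fun ω n => H.adapted.finite ω n (n + 1)

variable [IsProbabilityMeasure P]

/-- `κ` and its compensator give the same measure on the predictable σ-algebra. -/
lemma map_compProd_eq (H : HasPredictableIntensity P 𝓕 κ lam) :
    (P ⊗ₘ κ).map (toPred 𝓕) =
      ((P.prod volume).withDensity fun p => lam (toPred 𝓕 p)).map (toPred 𝓕) := by
  have := H.isSFiniteKernel
  have hl : Measurable fun p => lam (toPred 𝓕 p) := H.measurable.comp measurable_toPred
  have h1 : ∀ (A : Set Ω) (a b : ℝ), MeasurableSet[𝓕 a] A →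
      (P ⊗ₘ κ).map (toPred 𝓕) {x | x.1 ∈ A ∧ x.2 ∈ Ioc a b} = ∫⁻ ω in A, κ ω (Ioc a b) ∂P := by
    intro A a b hA
    have hA' := 𝓕.le a A hA
    rw [Measure.map_apply measurable_toPred (measurableSet_predRect b hA)]
    exact Measure.compProd_apply_prod hA' measurableSet_Ioc
  have h2 : ∀ (A : Set Ω) (a b : ℝ), MeasurableSet[𝓕 a] A →
      ((P.prod volume).withDensity fun p => lam (toPred 𝓕 p)).map (toPred 𝓕)
        {x | x.1 ∈ A ∧ x.2 ∈ Ioc a b} =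
      ∫⁻ ω in A, (∫⁻ u in Ioc a b, lam (toPred 𝓕 (ω, u))) ∂P := by
    intro A a b hA
    have hA' := 𝓕.le a A hA
    rw [Measure.map_apply measurable_toPred (measurableSet_predRect b hA)]
    change ((P.prod volume).withDensity fun p => lam (toPred 𝓕 p)) (A ×ˢ Ioc a b) = _
    rw [withDensity_apply _ (hA'.prod measurableSet_Ioc), ← Measure.prod_restrict,
      lintegral_prod _ hl.aemeasurable]
  refine Measure.ext_of_generateFrom_of_iUnion (predRect 𝓕)
    (fun n : ℕ => {x | x.1 ∈ univ ∧ x.2 ∈ Ioc (-n : ℝ) n}) rfl isPiSystem_predRect ?_ ?_ ?_ ?_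
  · ext x
    obtain ⟨n, hn⟩ := exists_nat_gt |x.2|
    simp only [mem_iUnion, mem_univ, iff_true]
    exact ⟨n, mem_univ x.1, (abs_lt.1 hn).1, (abs_lt.1 hn).2.le⟩
  · exact fun n => ⟨univ, -n, n, .univ, rfl⟩
  · intro n
    rw [h1 _ _ _ .univ, Measure.restrict_univ]
    exact H.finite_mean _ _
  · rintro _ ⟨A, a, b, hA, rfl⟩
    rw [h1 A a b hA, h2 A a b hA]
    exact H.compensator a b A hA

lemma lintegral_eq (H : HasPredictableIntensity P 𝓕 κ lam) {g : PredSpace 𝓕 → ℝ≥0∞}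
    (hg : Measurable g) :
    ∫⁻ ω, ∫⁻ u, g (toPred 𝓕 (ω, u)) ∂κ ω ∂P =
      ∫⁻ ω, (∫⁻ u, g (toPred 𝓕 (ω, u)) * lam (toPred 𝓕 (ω, u))) ∂P := by
  have := H.isSFiniteKernel
  have hg' : Measurable fun p => g (toPred 𝓕 p) := hg.comp measurable_toPred
  have hl : Measurable fun p => lam (toPred 𝓕 p) := H.measurable.comp measurable_toPred
  have h := congrArg (fun μ => ∫⁻ x, g x ∂μ) H.map_compProd_eq
  simp only [lintegral_map hg measurable_toPred] at h
  rw [Measure.lintegral_compProd hg', lintegral_withDensity_eq_lintegral_mul _ hl hg',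
    lintegral_prod _ (hl.mul hg').aemeasurable] at h
  simpa only [Pi.mul_apply, mul_comm] using h

lemma ae_lam_ne_top (H : HasPredictableIntensity P 𝓕 κ lam) :
    ∀ᵐ p ∂P.prod volume, lam (toPred 𝓕 p) ≠ ∞ := by
  have hl : Measurable fun p => lam (toPred 𝓕 p) := H.measurable.comp measurable_toPred
  have hn : ∀ n : ℕ, ∀ᵐ p ∂P.prod (volume.restrict (Ioc (-n : ℝ) n)), lam (toPred 𝓕 p) ≠ ∞ := by
    intro n
    refine (ae_lt_top hl ?_).mono fun p hp => hp.ne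
    rw [lintegral_prod _ hl.aemeasurable]
    have := H.compensator (-n) n univ .univ
    simp only [Measure.restrict_univ] at this
    rw [← this]
    exact H.finite_mean _ _
  have hn' : ∀ n : ℕ, ∀ᵐ p ∂P.prod volume, p.2 ∈ Ioc (-n : ℝ) n → lam (toPred 𝓕 p) ≠ ∞ := by
    intro n
    have hS : MeasurableSet {p : Ω × ℝ | p.2 ∈ Ioc (-n : ℝ) n} := measurable_snd measurableSet_Ioc
    refine (ae_restrict_iff' hS).1 ?_
    have : {p : Ω × ℝ | p.2 ∈ Ioc (-n : ℝ) n} = univ ×ˢ Ioc (-n : ℝ) n := by ext; simp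
    rw [this, ← Measure.prod_restrict, Measure.restrict_univ]
    exact hn n
  filter_upwards [ae_all_iff.2 hn'] with p hp
  obtain ⟨n, hn⟩ := exists_nat_gt |p.2|
  exact hp n ⟨(abs_lt.1 hn).1, (abs_lt.1 hn).2.le⟩

lemma integrable_mul_lam (H : HasPredictableIntensity P 𝓕 κ lam) {g : PredSpace 𝓕 → ℝ}
    (hg : Measurable g) (hi : Integrable (fun p => g (toPred 𝓕 p)) (P ⊗ₘ κ)) :
    Integrable (fun p => g (toPred 𝓕 p) * (lam (toPred 𝓕 p)).toReal) (P.prod volume) ∧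
    ∫ p, g (toPred 𝓕 p) ∂(P ⊗ₘ κ) =
      ∫ p, g (toPred 𝓕 p) * (lam (toPred 𝓕 p)).toReal ∂(P.prod volume) := by
  have hl : Measurable fun p => lam (toPred 𝓕 p) := H.measurable.comp measurable_toPred
  have hfin : ∀ᵐ p ∂P.prod volume, lam (toPred 𝓕 p) < ∞ :=
    H.ae_lam_ne_top.mono fun p hp => hp.lt_top
  have e1 : Integrable g ((P ⊗ₘ κ).map (toPred 𝓕)) :=
    (integrable_map_measure hg.aestronglyMeasurable measurable_toPred.aemeasurable).2 hi
  constructor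
  · rw [H.map_compProd_eq, integrable_map_measure hg.aestronglyMeasurable
      measurable_toPred.aemeasurable] at e1
    have := (integrable_withDensity_iff hl hfin).1 e1
    exact this
  · have h := congrArg (fun μ => ∫ x, g x ∂μ) H.map_compProd_eq
    simp only [integral_map measurable_toPred.aemeasurable hg.aestronglyMeasurable] at h
    rw [h, integral_withDensity_eq_integral_toReal_smul hl hfin]
    simp only [smul_eq_mul, mul_comm]

lemma ae_integrable (H : HasPredictableIntensity P 𝓕 κ lam) {g : PredSpace 𝓕 → ℝ}
    (hg : Measurable g) (hi : Integrable (fun p => g (toPred 𝓕 p)) (P ⊗ₘ κ)) :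
    ∀ᵐ ω ∂P, Integrable (fun u => g (toPred 𝓕 (ω, u))) (κ ω) ∧
      Integrable (fun u => g (toPred 𝓕 (ω, u)) * (lam (toPred 𝓕 (ω, u))).toReal) volume := by
  have := H.isSFiniteKernel
  exact ((Measure.integrable_compProd_iff hi.1).1 hi).1.and (H.integrable_mul_lam hg hi).1.prod_right_ae

lemma integrable_compIntegral (H : HasPredictableIntensity P 𝓕 κ lam) {g : PredSpace 𝓕 → ℝ}
    (hg : Measurable g) (hi : Integrable (fun p => g (toPred 𝓕 p)) (P ⊗ₘ κ)) :
    Integrable (compIntegral κ lam g) P ∧ ∫ ω, compIntegral κ lam g ω ∂P = 0 := by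
  have := H.isSFiniteKernel
  obtain ⟨h1, h2⟩ := H.integrable_mul_lam hg hi
  have i1 := integrable_integral_of_integrable_compProd hi
  have i2 := h1.integral_prod_left
  refine ⟨i1.sub i2, ?_⟩
  unfold compIntegral
  rw [integral_sub i1 i2, ← Measure.integral_compProd hi, h2, integral_prod _ h1, sub_self]

end HasPredictableIntensity

end Compensated

/-! ### The isometry for compensated integrals -/

section Isometry

variable {Ω : Type*} {mΩ : MeasurableSpace Ω} {P : Measure Ω} {𝓕 : Filtration ℝ mΩ}
  {κ : Kernel Ω ℝ} {lam : PredSpace 𝓕 → ℝ≥0∞} {g g₁ g₂ : PredSpace 𝓕 → ℝ}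

/-- The sum, at `x = (ω, t)`, of the total variations over the strict past of `t` of the signed
measures `g dκ` and `g(u) lam(u) du`. -/
def pastVariation (κ : Kernel Ω ℝ) (lam : PredSpace 𝓕 → ℝ≥0∞) (g : PredSpace 𝓕 → ℝ)
    (x : PredSpace 𝓕) : ℝ≥0∞ :=
  (∫⁻ u in Iio x.2, ‖g (toPred 𝓕 (x.1, u))‖ₑ ∂κ x.1) +
    ∫⁻ u in Iio x.2, ‖g (toPred 𝓕 (x.1, u))‖ₑ * lam (toPred 𝓕 (x.1, u))

/-- The square of a sum, with the factor `1` left by specialising `a + c * b` to `c = 1`. -/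
lemma integral_add_one_mul_sq {α : Type*} [MeasurableSpace α] {μ : Measure α} {a b : α → ℝ}
    (ha : MemLp a 2 μ) (hb : MemLp b 2 μ) :
    ∫ x, (a x + 1 * b x) ^ 2 ∂μ = ∫ x, a x ^ 2 ∂μ + ∫ x, b x ^ 2 ∂μ + 2 * ∫ x, a x * b x ∂μ := by
  have hab : Integrable (fun x => 2 * (a x * b x)) μ := (ha.integrable_mul hb).const_mul 2
  have hs : Integrable (fun x => a x ^ 2 + b x ^ 2) μ := ha.integrable_sq.add hb.integrable_sq
  rw [← integral_const_mul, ← integral_add ha.integrable_sq hb.integrable_sq,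
    ← integral_add hs hab]
  congr 1 with x
  ring

lemma enorm_mul_toReal_le (a : ℝ) (b : ℝ≥0∞) : ‖a * b.toReal‖ₑ ≤ ‖a‖ₑ * b := by
  rw [enorm_mul]
  gcongr
  rw [Real.enorm_of_nonneg ENNReal.toReal_nonneg]
  exact ENNReal.ofReal_toReal_le

lemma pastVariation_mono {g' : PredSpace 𝓕 → ℝ} (hg : ∀ x, ‖g' x‖ₑ ≤ ‖g x‖ₑ) (x : PredSpace 𝓕) :
    pastVariation κ lam g' x ≤ pastVariation κ lam g x := by
  unfold pastVariation
  gcongr <;> exact hg _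

/-- The restriction of the integrand `g` to the times at which the variation of the past is at most
`L`. -/
def truncate (κ : Kernel Ω ℝ) (lam : PredSpace 𝓕 → ℝ≥0∞) (g : PredSpace 𝓕 → ℝ) (L : ℕ) :
    PredSpace 𝓕 → ℝ :=
  {x | pastVariation κ lam g x ≤ L}.indicator g

lemma integrable_of_abs_le (hi : Integrable (fun p => g (toPred 𝓕 p)) (P ⊗ₘ κ))
    (hg₁ : Measurable g₁) (hle : ∀ x, |g₁ x| ≤ |g x|) :
    Integrable (fun p => g₁ (toPred 𝓕 p)) (P ⊗ₘ κ) :=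
  hi.mono (hg₁.comp measurable_toPred).aestronglyMeasurable (.of_forall fun _ => hle _)

lemma integrable_sq_of_abs_le (hi : Integrable (fun p => g (toPred 𝓕 p)) (P ⊗ₘ κ))
    (hg : Measurable g) {C : ℝ} (hC : ∀ x, |g x| ≤ C) :
    Integrable (fun p => g (toPred 𝓕 p) ^ 2) (P ⊗ₘ κ) := by
  refine (hi.const_mul C).mono ((hg.pow_const 2).comp measurable_toPred).aestronglyMeasurable
    (.of_forall fun p => ?_)
  rw [norm_pow, sq, norm_mul, Real.norm_eq_abs C]
  gcongr
  exact (hC _).trans (le_abs_self C)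

lemma truncate_of_le {L : ℕ} {x : PredSpace 𝓕} (hx : pastVariation κ lam g x ≤ L) :
    truncate κ lam g L x = g x := by
  have : x ∈ {x | pastVariation κ lam g x ≤ L} := hx
  exact indicator_of_mem this g

lemma le_of_truncate_ne_zero {L : ℕ} {x : PredSpace 𝓕} (hx : truncate κ lam g L x ≠ 0) :
    pastVariation κ lam g x ≤ L :=
  mem_of_indicator_ne_zero (s := {x | pastVariation κ lam g x ≤ L}) hx

lemma abs_truncate_le (L : ℕ) (x : PredSpace 𝓕) : |truncate κ lam g L x| ≤ |g x| := by
  unfold truncate indicator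
  split_ifs <;> simp

namespace HasPredictableIntensity

lemma measurable_pastVariation (H : HasPredictableIntensity P 𝓕 κ lam) (hg : Measurable g) :
    Measurable (pastVariation κ lam g) := by
  refine Measurable.add ?_ ?_
  · exact H.adapted.measurable_lintegral_past (G := fun _ y => ‖g y‖ₑ)
      (hg.enorm.comp measurable_snd)
  · exact isAdaptedMeasure_volume.measurable_lintegral_past (G := fun _ y => ‖g y‖ₑ * lam y)
      ((hg.enorm.mul H.measurable).comp measurable_snd)

lemma measurable_truncate (H : HasPredictableIntensity P 𝓕 κ lam) (hg : Measurable g) (L : ℕ) :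
    Measurable (truncate κ lam g L) :=
  hg.indicator (measurableSet_le (H.measurable_pastVariation hg) measurable_const)

variable [IsProbabilityMeasure P]

lemma ae_compIntegral_add_mul (H : HasPredictableIntensity P 𝓕 κ lam)
    (hg₁ : Measurable g₁) (hi₁ : Integrable (fun p => g₁ (toPred 𝓕 p)) (P ⊗ₘ κ))
    (hg₂ : Measurable g₂) (hi₂ : Integrable (fun p => g₂ (toPred 𝓕 p)) (P ⊗ₘ κ)) (c : ℝ) :
    compIntegral κ lam (fun x => g₁ x + c * g₂ x) =ᵐ[P]
      fun ω => compIntegral κ lam g₁ ω + c * compIntegral κ lam g₂ ω := by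
  filter_upwards [H.ae_integrable hg₁ hi₁, H.ae_integrable hg₂ hi₂] with ω h1 h2
  unfold compIntegral
  simp only [add_mul, mul_assoc]
  rw [integral_add h1.1 (h2.1.const_mul c), integral_add h1.2 (h2.2.const_mul c),
    integral_const_mul, integral_const_mul]
  ring

/-- The isometry when the variation of the past is bounded on the support of the integrand: the
running integral is then bounded there, so it may be used as a factor of a predictable integrand,
whose compensated integral is centred. -/
lemma isometry_of_pastVariation_le (H : HasPredictableIntensity P 𝓕 κ lam) (hg : Measurable g)
    (hi : Integrable (fun p => g (toPred 𝓕 p)) (P ⊗ₘ κ)) {C : ℝ} (hC : ∀ x, |g x| ≤ C) {L : ℝ≥0}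
    (hL : ∀ x, g x ≠ 0 → pastVariation κ lam g x ≤ L) :
    MemLp (compIntegral κ lam g) 2 P ∧
      ∫ ω, compIntegral κ lam g ω ^ 2 ∂P = ∫ p, g (toPred 𝓕 p) ^ 2 ∂(P ⊗ₘ κ) := by
  have := H.isSFiniteKernel
  have hl : Measurable fun x => (lam x).toReal := H.measurable.ennreal_toReal
  let U : PredSpace 𝓕 → ℝ := fun x => (∫ u in Iio x.2, g (toPred 𝓕 (x.1, u)) ∂κ x.1) -
    ∫ u in Iio x.2, g (toPred 𝓕 (x.1, u)) * (lam (toPred 𝓕 (x.1, u))).toReal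
  have hU : Measurable U := (H.adapted.measurable_integral_past hg).sub
    (isAdaptedMeasure_volume.measurable_integral_past (hg.mul hl))
  have hUle : ∀ x, ‖U x‖ₑ ≤ pastVariation κ lam g x := by
    intro x
    refine enorm_sub_le.trans (add_le_add ?_ ?_)
    · exact enorm_integral_le_lintegral_enorm _
    · exact (enorm_integral_le_lintegral_enorm _).trans
        (lintegral_mono fun u => enorm_mul_toReal_le _ _)
  let Z : PredSpace 𝓕 → ℝ := fun x => g x * U x
  have hZ : Measurable Z := hg.mul hU
  have hZle : ∀ x, ‖Z x‖ ≤ ‖L * g x‖ := by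
    intro x
    by_cases hx : g x = 0
    · simp [Z, hx]
    · have h1 : ‖U x‖ₑ ≤ L := (hUle x).trans (hL x hx)
      have h2 : ‖U x‖ ≤ L := by
        rw [← coe_nnnorm]
        exact_mod_cast (show (‖U x‖₊ : ℝ≥0∞) ≤ L from h1)
      simp only [Z, norm_mul]
      rw [mul_comm]
      gcongr
      simpa using h2
  have hZi : Integrable (fun p => Z (toPred 𝓕 p)) (P ⊗ₘ κ) :=
    (hi.const_mul (L : ℝ)).mono (hZ.comp measurable_toPred).aestronglyMeasurable
      (.of_forall fun p => hZle _)
  have hsqi := integrable_sq_of_abs_le hi hg hC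
  obtain ⟨z1, z2⟩ := H.integrable_compIntegral hZ hZi
  have hpath : (fun ω => compIntegral κ lam g ω ^ 2) =ᵐ[P]
      fun ω => 2 * compIntegral κ lam Z ω + ∫ u, g (toPred 𝓕 (ω, u)) ^ 2 ∂κ ω := by
    filter_upwards [H.ae_integrable hg hi] with ω hω
    have := sq_integral_sub_integral (H.simple ω) hω.1 hω.2
    refine this.trans ?_
    congr 3
    refine integral_congr_ae (.of_forall fun s => ?_)
    change _ * U (toPred 𝓕 (ω, s)) = g (toPred 𝓕 (ω, s)) * U (toPred 𝓕 (ω, s)) * _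
    ring
  have hi2 := integrable_integral_of_integrable_compProd hsqi
  have hVi : Integrable (fun ω => compIntegral κ lam g ω ^ 2) P :=
    ((z1.const_mul 2).add hi2).congr hpath.symm
  refine ⟨(memLp_two_iff_integrable_sq (H.integrable_compIntegral hg hi).1.1).2 hVi, ?_⟩
  rw [integral_congr_ae hpath, integral_add (z1.const_mul 2) hi2, integral_const_mul, z2,
    ← Measure.integral_compProd hsqi]
  ring

/-- Almost surely, the variation of the past is bounded uniformly in time. -/
lemma ae_exists_pastVariation_le (H : HasPredictableIntensity P 𝓕 κ lam) (hg : Measurable g)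
    (hi : Integrable (fun p => g (toPred 𝓕 p)) (P ⊗ₘ κ)) :
    ∀ᵐ ω ∂P, ∃ L₀ : ℕ, ∀ s, pastVariation κ lam g (toPred 𝓕 (ω, s)) ≤ L₀ := by
  have := H.isSFiniteKernel
  have m1 : Measurable fun p => ‖g (toPred 𝓕 p)‖ₑ := hg.enorm.comp measurable_toPred
  have m2 : Measurable fun p => ‖g (toPred 𝓕 p)‖ₑ * lam (toPred 𝓕 p) :=
    (hg.enorm.mul H.measurable).comp measurable_toPred
  have f1 : ∫⁻ ω, ∫⁻ u, ‖g (toPred 𝓕 (ω, u))‖ₑ ∂κ ω ∂P ≠ ∞ := by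
    rw [← Measure.lintegral_compProd m1]
    exact hi.2.ne
  have f2 := f1
  rw [H.lintegral_eq hg.enorm] at f2
  filter_upwards [ae_lt_top (m1.lintegral_kernel_prod_right' (κ := κ)) f1,
    ae_lt_top m2.lintegral_prod_right' f2] with ω h1 h2
  obtain ⟨L₀, hL⟩ := ENNReal.exists_nat_gt (ENNReal.add_lt_top.2 ⟨h1, h2⟩).ne
  refine ⟨L₀, fun s => le_trans ?_ hL.le⟩
  exact add_le_add (setLIntegral_le_lintegral _ _) (setLIntegral_le_lintegral _ _)

lemma isometry_truncate (H : HasPredictableIntensity P 𝓕 κ lam) (hg : Measurable g)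
    (hi : Integrable (fun p => g (toPred 𝓕 p)) (P ⊗ₘ κ)) {C : ℝ} (hC : ∀ x, |g x| ≤ C) (L : ℕ) :
    MemLp (compIntegral κ lam (truncate κ lam g L)) 2 P ∧
      ∫ ω, compIntegral κ lam (truncate κ lam g L) ω ^ 2 ∂P =
        ∫ p, truncate κ lam g L (toPred 𝓕 p) ^ 2 ∂(P ⊗ₘ κ) := by
  have hm := H.measurable_truncate hg L
  refine H.isometry_of_pastVariation_le hm (integrable_of_abs_le hi hm (abs_truncate_le L))
    (fun x => (abs_truncate_le L x).trans (hC x)) (L := L) fun x hx => ?_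
  refine (pastVariation_mono (fun y => ?_) x).trans (?_ : pastVariation κ lam g x ≤ L)
  · exact enorm_le_iff_norm_le.2 (abs_truncate_le L y)
  · exact le_of_truncate_ne_zero hx

/-- Half of the isometry, by Fatou's lemma along the truncations of the integrand. -/
lemma memLp_compIntegral (H : HasPredictableIntensity P 𝓕 κ lam) (hg : Measurable g)
    (hi : Integrable (fun p => g (toPred 𝓕 p)) (P ⊗ₘ κ)) {C : ℝ} (hC : ∀ x, |g x| ≤ C) :
    MemLp (compIntegral κ lam g) 2 P ∧
      ∫ ω, compIntegral κ lam g ω ^ 2 ∂P ≤ ∫ p, g (toPred 𝓕 p) ^ 2 ∂(P ⊗ₘ κ) := by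
  have := H.isSFiniteKernel
  have hsq := integrable_sq_of_abs_le hi hg hC
  have hV := (H.integrable_compIntegral hg hi).1.1
  have hT := fun L => H.isometry_truncate hg hi hC L
  have hle : ∫⁻ ω, ENNReal.ofReal (compIntegral κ lam g ω ^ 2) ∂P ≤
      ENNReal.ofReal (∫ p, g (toPred 𝓕 p) ^ 2 ∂(P ⊗ₘ κ)) := by
    calc ∫⁻ ω, ENNReal.ofReal (compIntegral κ lam g ω ^ 2) ∂P
        = ∫⁻ ω, Filter.liminf (fun L : ℕ =>
            ENNReal.ofReal (compIntegral κ lam (truncate κ lam g L) ω ^ 2)) Filter.atTop ∂P := by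
          refine lintegral_congr_ae ?_
          filter_upwards [H.ae_exists_pastVariation_le hg hi] with ω ⟨L₀, hL₀⟩
          refine (Filter.Tendsto.liminf_eq (tendsto_const_nhds.congr' ?_)).symm
          filter_upwards [Filter.eventually_ge_atTop L₀] with L hL
          have : ∀ s, truncate κ lam g L (toPred 𝓕 (ω, s)) = g (toPred 𝓕 (ω, s)) := fun s =>
            truncate_of_le ((hL₀ s).trans (by exact_mod_cast hL))
          simp only [compIntegral, this]
      _ ≤ Filter.liminf (fun L : ℕ => ∫⁻ ω,
            ENNReal.ofReal (compIntegral κ lam (truncate κ lam g L) ω ^ 2) ∂P) Filter.atTop :=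
          lintegral_liminf_le' fun L =>
            ((hT L).1.1.aemeasurable.pow_const 2).ennreal_ofReal
      _ ≤ ENNReal.ofReal (∫ p, g (toPred 𝓕 p) ^ 2 ∂(P ⊗ₘ κ)) := by
          refine Filter.liminf_le_of_le (by isBoundedDefault) fun b hb => ?_
          obtain ⟨L, hL⟩ := hb.exists
          refine hL.trans ?_
          rw [← ofReal_integral_eq_lintegral_ofReal (hT L).1.integrable_sq
            (.of_forall fun _ => sq_nonneg _), (hT L).2]
          refine ENNReal.ofReal_le_ofReal (integral_mono_of_nonneg
            (.of_forall fun _ => sq_nonneg _) hsq (.of_forall fun p => ?_))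
          exact sq_le_sq.2 (abs_truncate_le L _)
  have hVi : Integrable (fun ω => compIntegral κ lam g ω ^ 2) P := by
    refine ⟨hV.pow 2, ?_⟩
    rw [hasFiniteIntegral_iff_ofReal (.of_forall fun _ => sq_nonneg _)]
    exact hle.trans_lt ENNReal.ofReal_lt_top
  refine ⟨(memLp_two_iff_integrable_sq hV).2 hVi, ?_⟩
  rw [← ofReal_integral_eq_lintegral_ofReal hVi (.of_forall fun _ => sq_nonneg _)] at hle
  exact (ENNReal.ofReal_le_ofReal_iff (integral_nonneg fun _ => sq_nonneg _)).1 hle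

/-- The isometry for bounded integrable predictable integrands. -/
lemma integral_sq_compIntegral (H : HasPredictableIntensity P 𝓕 κ lam) (hg : Measurable g)
    (hi : Integrable (fun p => g (toPred 𝓕 p)) (P ⊗ₘ κ)) {C : ℝ} (hC : ∀ x, |g x| ≤ C) :
    ∫ ω, compIntegral κ lam g ω ^ 2 ∂P = ∫ p, g (toPred 𝓕 p) ^ 2 ∂(P ⊗ₘ κ) := by
  have := H.isSFiniteKernel
  refine le_antisymm (H.memLp_compIntegral hg hi hC).2 ?_
  have hsq := integrable_sq_of_abs_le hi hg hC
  have hm := fun L => H.measurable_truncate hg L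
  -- The parallelogram identity for the truncation `T` and the remainder `g - T`: both `g` and
  -- `T - (g - T)` have square `g ^ 2`, and the upper bound applies to the second.
  have hlow : ∀ L : ℕ, 2 * ∫ p, truncate κ lam g L (toPred 𝓕 p) ^ 2 ∂(P ⊗ₘ κ) -
      ∫ p, g (toPred 𝓕 p) ^ 2 ∂(P ⊗ₘ κ) ≤ ∫ ω, compIntegral κ lam g ω ^ 2 ∂P := by
    intro L
    set T := truncate κ lam g L with hTdef
    have hTi := integrable_of_abs_le hi (hm L) (abs_truncate_le L)
    have hrefl : ∀ x, |g x + -2 * T x| = |g x| := by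
      intro x
      simp only [hTdef, truncate, indicator]
      split_ifs
      · rw [show g x + -2 * g x = -g x by ring, abs_neg]
      · simp
    have hDm : Measurable fun x => g x + -2 * T x := hg.add ((hm L).const_mul _)
    have hDi := integrable_of_abs_le hi hDm fun x => (hrefl x).le
    have hD := H.memLp_compIntegral hDm hDi (C := C) fun x => (hrefl x).le.trans (hC x)
    have hVD := H.ae_compIntegral_add_mul hg hi (hm L) hTi (-2)
    have hV := (H.memLp_compIntegral hg hi hC).1
    obtain ⟨hT1, hT2⟩ := H.isometry_truncate hg hi hC L
    have e1 : ∫ p, (g (toPred 𝓕 p) + -2 * T (toPred 𝓕 p)) ^ 2 ∂(P ⊗ₘ κ) =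
        ∫ p, g (toPred 𝓕 p) ^ 2 ∂(P ⊗ₘ κ) :=
      integral_congr_ae (.of_forall fun p => (sq_eq_sq_iff_abs_eq_abs _ _).2 (hrefl _))
    have e2 : ∫ ω, 2 * compIntegral κ lam T ω ^ 2 ∂P ≤
        ∫ ω, (compIntegral κ lam g ω ^ 2 +
          compIntegral κ lam (fun x => g x + -2 * T x) ω ^ 2) ∂P := by
      refine integral_mono_ae (hT1.integrable_sq.const_mul 2)
        (hV.integrable_sq.add hD.1.integrable_sq) ?_
      filter_upwards [hVD] with ω hω
      rw [hω]
      nlinarith [sq_nonneg (compIntegral κ lam g ω - compIntegral κ lam T ω)]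
    rw [integral_const_mul, integral_add hV.integrable_sq hD.1.integrable_sq, hT2] at e2
    linarith [hD.2]
  have hlim : Filter.Tendsto (fun L : ℕ => ∫ p, truncate κ lam g L (toPred 𝓕 p) ^ 2 ∂(P ⊗ₘ κ))
      Filter.atTop (nhds (∫ p, g (toPred 𝓕 p) ^ 2 ∂(P ⊗ₘ κ))) := by
    refine tendsto_integral_of_dominated_convergence (fun p => g (toPred 𝓕 p) ^ 2)
      (fun L => ((hm L).pow_const 2 |>.comp measurable_toPred).aestronglyMeasurable) hsq
      (fun L => .of_forall fun p => ?_) ?_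
    · rw [Real.norm_of_nonneg (sq_nonneg _)]
      exact sq_le_sq.2 (abs_truncate_le L _)
    · have hfin : ∀ᵐ p ∂(P ⊗ₘ κ), pastVariation κ lam g (toPred 𝓕 p) < ∞ := by
        refine (Measure.ae_compProd_iff (measurableSet_lt
          ((H.measurable_pastVariation hg).comp measurable_toPred) measurable_const)).2 ?_
        filter_upwards [H.ae_exists_pastVariation_le hg hi] with ω ⟨L₀, hL₀⟩
        exact .of_forall fun s => (hL₀ s).trans_lt (ENNReal.natCast_lt_top L₀)
      filter_upwards [hfin] with p hp
      obtain ⟨L₀, hL₀⟩ := ENNReal.exists_nat_gt hp.ne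
      refine tendsto_const_nhds.congr' ?_
      filter_upwards [Filter.eventually_ge_atTop L₀] with L hL
      have : truncate κ lam g L (toPred 𝓕 p) = g (toPred 𝓕 p) :=
        truncate_of_le (hL₀.le.trans (by exact_mod_cast hL))
      rw [this]
  have := le_of_tendsto' (b := ∫ ω, compIntegral κ lam g ω ^ 2 ∂P)
    ((hlim.const_mul 2).sub_const (∫ p, g (toPred 𝓕 p) ^ 2 ∂(P ⊗ₘ κ))) hlow
  linarith

/-- The polarised isometry. -/
lemma integral_compIntegral_mul (H : HasPredictableIntensity P 𝓕 κ lam)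
    (hg₁ : Measurable g₁) (hi₁ : Integrable (fun p => g₁ (toPred 𝓕 p)) (P ⊗ₘ κ))
    (hg₂ : Measurable g₂) (hi₂ : Integrable (fun p => g₂ (toPred 𝓕 p)) (P ⊗ₘ κ)) {C : ℝ}
    (hC₁ : ∀ x, |g₁ x| ≤ C) (hC₂ : ∀ x, |g₂ x| ≤ C) :
    ∫ ω, compIntegral κ lam g₁ ω * compIntegral κ lam g₂ ω ∂P =
      ∫ p, g₁ (toPred 𝓕 p) * g₂ (toPred 𝓕 p) ∂(P ⊗ₘ κ) := by
  have hV₁ := (H.memLp_compIntegral hg₁ hi₁ hC₁).1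
  have hV₂ := (H.memLp_compIntegral hg₂ hi₂ hC₂).1
  have sq₁ := integrable_sq_of_abs_le hi₁ hg₁ hC₁
  have sq₂ := integrable_sq_of_abs_le hi₂ hg₂ hC₂
  have m₁ := memLp_two_iff_integrable_sq (hg₁.comp measurable_toPred).aestronglyMeasurable |>.2 sq₁
  have m₂ := memLp_two_iff_integrable_sq (hg₂.comp measurable_toPred).aestronglyMeasurable |>.2 sq₂
  have hm : Measurable fun x => g₁ x + 1 * g₂ x := hg₁.add (hg₂.const_mul 1)
  have hi : Integrable (fun p => g₁ (toPred 𝓕 p) + 1 * g₂ (toPred 𝓕 p)) (P ⊗ₘ κ) :=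
    hi₁.add (hi₂.const_mul 1)
  have e := H.integral_sq_compIntegral hm hi (C := C + C) fun x =>
    (abs_add_le _ _).trans (add_le_add (hC₁ x) (by simpa using hC₂ x))
  have e₁ := H.integral_sq_compIntegral hg₁ hi₁ hC₁
  have e₂ := H.integral_sq_compIntegral hg₂ hi₂ hC₂
  have ev : ∫ ω, compIntegral κ lam (fun x => g₁ x + 1 * g₂ x) ω ^ 2 ∂P =
      ∫ ω, (compIntegral κ lam g₁ ω + 1 * compIntegral κ lam g₂ ω) ^ 2 ∂P :=
    integral_congr_ae ((H.ae_compIntegral_add_mul hg₁ hi₁ hg₂ hi₂ 1).fun_comp (· ^ 2))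
  rw [ev] at e
  have em := integral_add_one_mul_sq m₁ m₂
  rw [integral_add_one_mul_sq hV₁ hV₂] at e
  simp only [Function.comp_apply] at em
  linarith

end HasPredictableIntensity

end Isometry

/-! ### The resolvent measure -/

section Resolvent

/-- The convolution powers of the measure `h(t) dt`. -/
def convPower (h : ℝ → ℝ≥0) : ℕ → Measure ℝ
  | 0 => Measure.dirac 0
  | n + 1 => (volume.withDensity fun t => (h t : ℝ≥0∞)) ∗ convPower h n

lemma lintegral_Ioi_mul_comp_sub {h : ℝ → ℝ≥0} (hsupp : ∀ t < 0, h t = 0) (φ : ℝ → ℝ≥0∞) (v : ℝ) :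
    ∫⁻ u in Ioi v, φ u * h (u - v) = ∫⁻ w, h w * φ (v + w) := by
  rw [← lintegral_indicator measurableSet_Ioi,
    ← lintegral_add_left_eq_self (fun u => (Ioi v).indicator (fun u => φ u * h (u - v)) u) v]
  refine lintegral_congr_ae ?_
  filter_upwards [Measure.ae_ne volume 0] with w hw
  rcases lt_or_gt_of_ne hw with hw | hw
  · rw [indicator_of_notMem (notMem_Ioi.2 (by linarith)), hsupp _ hw]
    simp
  · rw [indicator_of_mem (mem_Ioi.2 (by linarith)), add_sub_cancel_left, mul_comm]

/-- The resolvent `R = ∑ₙ (h dt)^{*n}`, the mean measure of the cluster generated by one immigrant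
at time `0`. -/
def resolvent (h : ℝ → ℝ≥0) : Measure ℝ := Measure.sum (convPower h)

variable {h : ℝ → ℝ≥0}

instance (n : ℕ) : SFinite (convPower h n) := by
  induction n with
  | zero => unfold convPower; infer_instance
  | succ n ih => unfold convPower; infer_instance

lemma lintegral_convPower_succ (hh : Measurable h) (n : ℕ) {φ : ℝ → ℝ≥0∞} (hφ : Measurable φ) :
    ∫⁻ x, φ x ∂convPower h (n + 1) = ∫⁻ w, h w * ∫⁻ y, φ (w + y) ∂convPower h n := by
  rw [convPower, Measure.lintegral_conv hφ, lintegral_withDensity_eq_lintegral_mul _ (by fun_prop)]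
  · rfl
  · exact Measurable.lintegral_prod_right' (f := fun p : ℝ × ℝ => φ (p.1 + p.2)) (by fun_prop)

/-- The renewal equation `R = δ₀ + h * R`. -/
lemma lintegral_resolvent (hh : Measurable h) {φ : ℝ → ℝ≥0∞} (hφ : Measurable φ) :
    ∫⁻ x, φ x ∂resolvent h = φ 0 + ∫⁻ w, h w * ∫⁻ y, φ (w + y) ∂resolvent h := by
  unfold resolvent
  simp only [lintegral_sum_measure]
  rw [tsum_eq_zero_add' ENNReal.summable]
  simp only [lintegral_convPower_succ hh _ hφ, ← ENNReal.tsum_mul_left]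
  rw [lintegral_tsum]
  · simp [convPower, lintegral_dirac' _ hφ]
  · intro n
    exact ((by fun_prop : Measurable fun w => (h w : ℝ≥0∞)).mul (Measurable.lintegral_prod_right'
      (f := fun p : ℝ × ℝ => φ (p.1 + p.2)) (by fun_prop))).aemeasurable

lemma convPower_univ (hh : Measurable h) (n : ℕ) :
    convPower h n univ = (∫⁻ t, (h t : ℝ≥0∞)) ^ n := by
  induction n with
  | zero => simp [convPower]
  | succ n ih =>
    have := lintegral_convPower_succ hh n (φ := fun _ => 1) measurable_const
    simp only [lintegral_one, ih] at this
    rw [this, lintegral_mul_const _ (by fun_prop), pow_succ, mul_comm]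

lemma resolvent_univ (hh : Measurable h) :
    resolvent h univ = (1 - ∫⁻ t, (h t : ℝ≥0∞))⁻¹ := by
  rw [resolvent, Measure.sum_apply _ .univ]
  simp only [convPower_univ hh, ENNReal.tsum_geometric]

lemma isFiniteMeasure_resolvent (hh : Measurable h) (hμ : ∫⁻ t, (h t : ℝ≥0∞) < 1) :
    IsFiniteMeasure (resolvent h) := by
  refine ⟨?_⟩
  rw [resolvent_univ hh, ENNReal.inv_lt_top]
  exact tsub_pos_of_lt hμ

instance : SFinite (resolvent h) := by unfold resolvent; infer_instance

/-- The response function `u ↦ R (a - u, b - u]` of an interval: the mean number of points in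
`(a, b]` of the cluster generated by one immigrant at time `u`. -/
def response (h : ℝ → ℝ≥0) (a b u : ℝ) : ℝ≥0∞ := resolvent h (Ioc (a - u) (b - u))

lemma response_eq_lintegral (a b u : ℝ) :
    response h a b u = ∫⁻ v, (Ioc a b).indicator 1 (u + v) ∂resolvent h := by
  rw [response, ← lintegral_indicator_one measurableSet_Ioc]
  refine lintegral_congr fun v => ?_
  simp only [indicator, mem_Ioc, sub_lt_iff_lt_add', le_sub_iff_add_le', Pi.one_apply]

@[fun_prop]
lemma measurable_response (a b : ℝ) : Measurable (response h a b) := by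
  have : response h a b =
      fun u => ∫⁻ v, (Ioc a b).indicator (1 : ℝ → ℝ≥0∞) (u + v) ∂resolvent h :=
    funext fun u => response_eq_lintegral a b u
  rw [this]
  exact Measurable.lintegral_prod_right'
    (f := fun p : ℝ × ℝ => (Ioc a b).indicator (1 : ℝ → ℝ≥0∞) (p.1 + p.2))
    ((measurable_one.indicator measurableSet_Ioc).comp measurable_add)

lemma response_le (a b u : ℝ) : response h a b u ≤ resolvent h univ := measure_mono (subset_univ _)

lemma response_add (a b u c : ℝ) : response h (a + c) (b + c) (u + c) = response h a b u := by
  unfold response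
  congr 2 <;> ring

/-- The response function solves the backward renewal equation. -/
lemma response_eq (hh : Measurable h) (a b u : ℝ) :
    response h a b u = (Ioc a b).indicator 1 u + ∫⁻ w, h w * response h a b (u + w) := by
  have hm : Measurable fun v => (Ioc a b).indicator (1 : ℝ → ℝ≥0∞) (u + v) :=
    (measurable_one.indicator measurableSet_Ioc).comp (measurable_const_add u)
  rw [response_eq_lintegral, lintegral_resolvent hh hm]
  simp only [response_eq_lintegral, add_zero, add_assoc]

lemma lintegral_response (a b : ℝ) :
    ∫⁻ u, response h a b u = ENNReal.ofReal (b - a) * resolvent h univ := by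
  simp only [response_eq_lintegral]
  rw [lintegral_lintegral_swap]
  · have : ∀ v, ∫⁻ u, (Ioc a b).indicator (1 : ℝ → ℝ≥0∞) (u + v) = ENNReal.ofReal (b - a) := by
      intro v
      rw [lintegral_add_right_eq_self (fun u => (Ioc a b).indicator (1 : ℝ → ℝ≥0∞) u),
        lintegral_indicator_one measurableSet_Ioc, Real.volume_Ioc]
    simp only [this, lintegral_const]
  · exact ((measurable_one.indicator measurableSet_Ioc).comp measurable_add).aemeasurable

end Resolvent

/-! ### Hawkes processes as compensated point processes -/

section Hawkes

variable {Ω : Type*} {mΩ : MeasurableSpace Ω} {P : Measure Ω} {η : ℝ≥0} {h : ℝ → ℝ≥0}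
  {N : Ω → Measure ℝ}

/-- The internal history `s ↦ σ(N(B) : B ⊆ (-∞, s])` as a filtration. -/
def internalHistory (hN : Measurable N) : Filtration ℝ mΩ where
  seq s := sigmaOn N (Iic s)
  mono' _ _ hst := iSup_mono fun _ => iSup_mono fun _ =>
    iSup_le fun hBs => le_iSup_of_le (hBs.trans (Iic_subset_Iic.2 hst)) le_rfl
  le' _ := iSup_le fun _ => iSup_le fun hB => iSup_le fun _ =>
    ((Measure.measurable_coe hB).comp hN).comap_le

lemma IsSimpleCounting.Ioc_ne_top {ν : Measure ℝ} (hν : IsSimpleCounting ν) (a b : ℝ) :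
    ν (Ioc a b) ≠ ∞ := by
  obtain ⟨S, hS, rfl⟩ := hν
  rw [Measure.restrict_apply measurableSet_Ioc]
  have : (Ioc a b ∩ S).Finite := (hS a b).subset fun x hx => ⟨hx.2, Ioc_subset_Icc_self hx.1⟩
  exact (Measure.count_apply_lt_top.2 this).ne

lemma IsSimpleCounting.ae_singleton {ν : Measure ℝ} (hν : IsSimpleCounting ν) :
    ∀ᵐ s ∂ν, ν {s} = 1 := by
  obtain ⟨S, hS, rfl⟩ := hν
  have hc : S.Countable := by
    have : S = ⋃ n : ℕ, S ∩ Icc (-n : ℝ) n := by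
      ext x
      obtain ⟨n, hn⟩ := exists_nat_gt |x|
      simp only [mem_iUnion, mem_inter_iff, mem_Icc]
      exact ⟨fun hx => ⟨n, hx, (abs_lt.1 hn).1.le, (abs_lt.1 hn).2.le⟩, fun ⟨_, hx, _⟩ => hx⟩
    rw [this]
    exact countable_iUnion fun n => (hS _ _).countable
  rw [ae_restrict_iff' hc.measurableSet]
  refine .of_forall fun s hs => ?_
  rw [Measure.restrict_apply (measurableSet_singleton s), inter_eq_left.2 (by simpa using hs),
    Measure.count_singleton]

lemma IsSimplePointProcess.isAdaptedMeasure (hN : IsSimplePointProcess N) :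
    IsAdaptedMeasure (internalHistory hN.measurable) N where
  finite ω a b := (hN.counting ω).Ioc_ne_top a b
  adapted a b := by
    have h1 : MeasurableSpace.comap (fun ω => N ω (Ioc a b)) inferInstance ≤ sigmaOn N (Iic b) :=
      le_iSup_of_le (Ioc a b) (le_iSup_of_le measurableSet_Ioc
        (le_iSup_of_le Ioc_subset_Iic_self le_rfl))
    exact Measurable.of_comap_le h1

/-- A point process as a kernel. -/
def IsSimplePointProcess.kernel (hN : IsSimplePointProcess N) : Kernel Ω ℝ := ⟨N, hN.measurable⟩

/-- The Hawkes intensity as a function on the predictable space. -/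
def predIntensity (η : ℝ≥0) (h : ℝ → ℝ≥0) (hN : Measurable N)
    (x : PredSpace (internalHistory hN)) : ℝ≥0∞ :=
  hawkesIntensity η h N x.2 x.1

lemma IsSimplePointProcess.measurable_predIntensity (hN : IsSimplePointProcess N)
    (hh : Measurable h) : Measurable (predIntensity η h hN.measurable) := by
  have hG : Measurable (Function.uncurry fun x y : PredSpace (internalHistory hN.measurable) =>
      (h (x.2 - y.2) : ℝ≥0∞)) :=
    (hh.comp ((measurable_pred_snd.comp measurable_fst).sub
      (measurable_pred_snd.comp measurable_snd))).coe_nnreal_ennreal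
  exact (hN.isAdaptedMeasure.measurable_lintegral_past hG).const_add (η : ℝ≥0∞)

lemma IsSimplePointProcess.measurable_hawkesIntensity (hN : IsSimplePointProcess N)
    (hh : Measurable h) : Measurable fun p : Ω × ℝ => hawkesIntensity η h N p.2 p.1 :=
  (hN.measurable_predIntensity hh).comp measurable_toPred

/-- By stationarity, the mean measure of the process is a multiple of Lebesgue measure. -/
lemma IsStationaryHawkes.bind_eq [IsProbabilityMeasure P] (hN : IsStationaryHawkes P η h N) :
    P.bind N = (∫⁻ ω, N ω (Ioc 0 1) ∂P) • volume := by
  have hm := hN.pointProcess.measurable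
  have happ : ∀ B, MeasurableSet B → P.bind N B = ∫⁻ ω, N ω B ∂P := fun B hB =>
    Measure.bind_apply hB hm.aemeasurable
  have hinv : (P.bind N).IsAddLeftInvariant := by
    refine ⟨fun s => ?_⟩
    ext B hB
    have e := congrArg (fun Q => ∫⁻ ν : Measure ℝ, ν B ∂Q) (hN.stationary s)
    simp only [add_comm _ s] at e
    have hms : Measurable fun ω => (N ω).map fun x => s + x :=
      (Measure.measurable_map _ (measurable_const_add s)).comp hm
    rw [lintegral_map (Measure.measurable_coe hB) hms,
      lintegral_map (Measure.measurable_coe hB) hm] at e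
    rw [Measure.map_apply (measurable_const_add s) hB, happ _ hB,
      happ _ (measurable_const_add s hB), ← e]
    refine lintegral_congr fun ω => ?_
    rw [Measure.map_apply (measurable_const_add s) hB]
  have hfin : IsFiniteMeasureOnCompacts (P.bind N) := by
    refine ⟨fun K hK => ?_⟩
    refine measure_lt_top_of_isCompact_of_isAddLeftInvariant (Ioo (0 : ℝ) 1) isOpen_Ioo
      (nonempty_Ioo.2 one_pos) ?_ hK
    rw [happ _ measurableSet_Ioo]
    exact ne_top_of_le_ne_top hN.finite_mean
      (lintegral_mono fun ω => measure_mono Ioo_subset_Ioc_self)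
  have e := Measure.isAddLeftInvariant_eq_smul (P.bind N) volume
  set c := Measure.addHaarScalarFactor (P.bind N) volume
  have e1 : ∫⁻ ω, N ω (Ioc 0 1) ∂P = c := by
    rw [← happ _ measurableSet_Ioc, e, Measure.smul_apply, Real.volume_Ioc]
    simp [ENNReal.smul_def]
  rw [e1, e]
  rfl

lemma IsStationaryHawkes.lintegral_lintegral [IsProbabilityMeasure P]
    (hN : IsStationaryHawkes P η h N) {φ : ℝ → ℝ≥0∞} (hφ : Measurable φ) :
    ∫⁻ ω, ∫⁻ u, φ u ∂N ω ∂P = (∫⁻ ω, N ω (Ioc 0 1) ∂P) * ∫⁻ u, φ u := by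
  rw [← Measure.lintegral_bind hN.pointProcess.measurable.aemeasurable hφ.aemeasurable, hN.bind_eq,
    lintegral_smul_measure, smul_eq_mul]

lemma IsStationaryHawkes.hasPredictableIntensity [IsProbabilityMeasure P]
    (hN : IsStationaryHawkes P η h N) (hh : Measurable h) :
    HasPredictableIntensity P (internalHistory hN.pointProcess.measurable) hN.pointProcess.kernel
      (predIntensity η h hN.pointProcess.measurable) where
  adapted := hN.pointProcess.isAdaptedMeasure
  measurable := hN.pointProcess.measurable_predIntensity hh
  compensator s t A hA := by
    rcases le_total s t with hst | hst
    · exact hN.intensity s t hst A hA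
    · simp [Ioc_eq_empty_of_le hst]
  finite_mean a b := by
    have := hN.lintegral_lintegral (φ := (Ioc a b).indicator 1)
      (measurable_one.indicator measurableSet_Ioc)
    simp only [lintegral_indicator_one measurableSet_Ioc, Real.volume_Ioc] at this
    change ∫⁻ ω, N ω (Ioc a b) ∂P ≠ ∞
    rw [this]
    exact ENNReal.mul_ne_top hN.finite_mean ENNReal.ofReal_ne_top
  simple ω := (hN.pointProcess.counting ω).ae_singleton

variable [IsProbabilityMeasure P]

/-- The mean balance `m = η + m ∫ h`. -/
lemma IsStationaryHawkes.mean_eq (hN : IsStationaryHawkes P η h N) (hh : Measurable h)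
    (hsupp : ∀ t < 0, h t = 0) :
    ∫⁻ ω, N ω (Ioc 0 1) ∂P = η + (∫⁻ ω, N ω (Ioc 0 1) ∂P) * ∫⁻ t, (h t : ℝ≥0∞) := by
  have hm := hN.pointProcess.measurable_hawkesIntensity (η := η) hh
  have hlam : ∀ t, ∫⁻ ω, hawkesIntensity η h N t ω ∂P =
      η + (∫⁻ ω, N ω (Ioc 0 1) ∂P) * ∫⁻ t, (h t : ℝ≥0∞) := by
    intro t
    unfold hawkesIntensity
    rw [lintegral_add_left measurable_const, lintegral_const, measure_univ, mul_one]
    congr 1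
    have := hN.lintegral_lintegral (φ := (Iio t).indicator fun u => (h (t - u) : ℝ≥0∞))
      ((by fun_prop : Measurable fun u => (h (t - u) : ℝ≥0∞)).indicator measurableSet_Iio)
    simp only [lintegral_indicator measurableSet_Iio] at this
    rw [this]
    congr 1
    have h1 : ∫⁻ u in Iio t, (h (t - u) : ℝ≥0∞) = ∫⁻ u, (h (t - u) : ℝ≥0∞) := by
      rw [← lintegral_indicator measurableSet_Iio]
      refine lintegral_congr_ae ?_
      filter_upwards [Measure.ae_ne volume t] with u hu
      rcases lt_or_gt_of_ne hu with hu | hu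
      · rw [indicator_of_mem (mem_Iio.2 hu)]
      · rw [indicator_of_notMem (notMem_Iio.2 hu.le), hsupp _ (by linarith)]
        rfl
    rw [h1, lintegral_sub_left_eq_self (fun x => (h x : ℝ≥0∞)) t]
  have := hN.intensity 0 1 zero_le_one univ .univ
  simp only [Measure.restrict_univ] at this
  conv_lhs => rw [this]
  rw [lintegral_lintegral_swap hm.aemeasurable]
  simp [hlam]

end Hawkes

/-! ### Second-order properties of Hawkes counts -/

section SecondOrder

variable {Ω : Type*} {mΩ : MeasurableSpace Ω} {P : Measure Ω} {η : ℝ≥0} {h : ℝ → ℝ≥0}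
  {N : Ω → Measure ℝ}

/-- The pathwise form of the moving-average representation: integrating the response function
against the compensated process leaves, by the backward renewal equation, only the count of the
interval and the contribution of the immigrants. -/
lemma IsSimplePointProcess.lintegral_response_add (hN : IsSimplePointProcess N)
    (hh : Measurable h) (hsupp : ∀ t < 0, h t = 0) (a b : ℝ) (ω : Ω) :
    ∫⁻ u, response h a b u ∂N ω + η * ∫⁻ u, response h a b u =
      N ω (Ioc a b) + ∫⁻ u, response h a b u * hawkesIntensity η h N u ω := by
  have : IsSFiniteKernel hN.kernel :=
    isSFiniteKernel_of_partition _ (fun n : ℤ => Ioc (n : ℝ) (n + 1)) (fun _ => measurableSet_Ioc)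
      (pairwise_disjoint_Ioc_intCast ℝ) (iUnion_Ioc_intCast ℝ)
      fun ω n => hN.isAdaptedMeasure.finite ω n (n + 1)
  have : SFinite (N ω) := inferInstanceAs (SFinite (hN.kernel ω))
  have hf := measurable_response (h := h) a b
  have hm : Measurable fun p : ℝ × ℝ => (h (p.1 - p.2) : ℝ≥0∞) := by fun_prop
  have hind : MeasurableSet {p : ℝ × ℝ | p.2 < p.1} :=
    measurableSet_lt measurable_snd measurable_fst
  have e1 : ∫⁻ u, response h a b u * ∫⁻ v in Iio u, h (u - v) ∂N ω =
      ∫⁻ v, (∫⁻ w, h w * response h a b (v + w)) ∂N ω := by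
    calc ∫⁻ u, response h a b u * ∫⁻ v in Iio u, h (u - v) ∂N ω
        = ∫⁻ u, (∫⁻ v, {p : ℝ × ℝ | p.2 < p.1}.indicator
            (fun p => response h a b p.1 * h (p.1 - p.2)) (u, v) ∂N ω) := by
          refine lintegral_congr fun u => ?_
          rw [← lintegral_const_mul _ (by fun_prop),
            ← lintegral_indicator measurableSet_Iio]
          rfl
      _ = ∫⁻ v, (∫⁻ u, {p : ℝ × ℝ | p.2 < p.1}.indicator
            (fun p => response h a b p.1 * h (p.1 - p.2)) (u, v)) ∂N ω :=
          lintegral_lintegral_swap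
            (((hf.comp measurable_fst).mul hm).indicator hind).aemeasurable
      _ = ∫⁻ v, (∫⁻ w, h w * response h a b (v + w)) ∂N ω := by
          refine lintegral_congr fun v => ?_
          rw [← lintegral_Ioi_mul_comp_sub hsupp, ← lintegral_indicator measurableSet_Ioi]
          rfl
  have e2 : ∫⁻ u, response h a b u * hawkesIntensity η h N u ω =
      η * (∫⁻ u, response h a b u) + ∫⁻ v, (∫⁻ w, h w * response h a b (v + w)) ∂N ω := by
    unfold hawkesIntensity
    simp only [mul_add]
    rw [lintegral_add_left (hf.mul_const _), lintegral_mul_const _ hf, e1, mul_comm]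
  have e3 : ∫⁻ u, response h a b u ∂N ω =
      N ω (Ioc a b) + ∫⁻ v, (∫⁻ w, h w * response h a b (v + w)) ∂N ω := by
    rw [lintegral_congr (response_eq hh a b),
      lintegral_add_left (measurable_one.indicator measurableSet_Ioc),
      lintegral_indicator_one measurableSet_Ioc]
  rw [e2, e3]
  ring

lemma IsStationaryHawkes.meanIntensity_eq_toReal (hN : IsStationaryHawkes P η h N) :
    meanIntensity P N = (∫⁻ ω, N ω (Ioc 0 1) ∂P).toReal := by
  have hm : Measurable fun ω => N ω (Ioc 0 1) :=
    (Measure.measurable_coe measurableSet_Ioc).comp hN.pointProcess.measurable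
  exact integral_toReal hm.aemeasurable
    (.of_forall fun ω => ((hN.pointProcess.counting ω).Ioc_ne_top 0 1).lt_top)

lemma integral_coe_eq_toReal (hh : Measurable h) :
    ∫ t, (h t : ℝ) = (∫⁻ t, (h t : ℝ≥0∞)).toReal := by
  have := integral_toReal (μ := volume) (f := fun t => (h t : ℝ≥0∞)) (by fun_prop) (by simp)
  simpa using this

/-- The real response function. -/
def responseReal (h : ℝ → ℝ≥0) (a b u : ℝ) : ℝ := (response h a b u).toReal

lemma measurable_responseReal (a b : ℝ) : Measurable (responseReal h a b) :=
  (measurable_response a b).ennreal_toReal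

lemma responseReal_nonneg (a b u : ℝ) : 0 ≤ responseReal h a b u := ENNReal.toReal_nonneg

section Bounds

variable (hh : Measurable h) (hμ : ∫⁻ t, (h t : ℝ≥0∞) < 1)
include hh hμ

lemma response_ne_top (a b u : ℝ) : response h a b u ≠ ∞ := by
  have := isFiniteMeasure_resolvent hh hμ
  exact measure_ne_top _ _

lemma responseReal_le (a b u : ℝ) : responseReal h a b u ≤ (resolvent h).real univ := by
  have := isFiniteMeasure_resolvent hh hμ
  exact ENNReal.toReal_mono (measure_ne_top _ _) (response_le a b u)

lemma ofReal_responseReal (a b u : ℝ) :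
    ENNReal.ofReal (responseReal h a b u) = response h a b u :=
  ENNReal.ofReal_toReal (response_ne_top hh hμ a b u)

lemma integrable_responseReal (a b : ℝ) : Integrable (responseReal h a b) := by
  have := isFiniteMeasure_resolvent hh hμ
  refine ⟨(measurable_responseReal a b).aestronglyMeasurable, ?_⟩
  rw [hasFiniteIntegral_iff_ofReal (.of_forall (responseReal_nonneg a b))]
  simp only [ofReal_responseReal hh hμ, lintegral_response]
  finiteness

lemma integral_responseReal {a b : ℝ} (hab : a ≤ b) :
    ∫ u, responseReal h a b u = (b - a) * (resolvent h).real univ := by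
  unfold responseReal
  rw [integral_toReal (measurable_response a b).aemeasurable
    (.of_forall fun u => (response_ne_top hh hμ a b u).lt_top), lintegral_response,
    ENNReal.toReal_mul, ENNReal.toReal_ofReal (by linarith)]
  rfl

end Bounds

/-- A deterministic function of time as a function on the predictable space. -/
def predOfTime (𝓕 : Filtration ℝ mΩ) (f : ℝ → ℝ) (x : PredSpace 𝓕) : ℝ := f x.2

lemma measurable_predOfTime {𝓕 : Filtration ℝ mΩ} {f : ℝ → ℝ} (hf : Measurable f) :
    Measurable (predOfTime 𝓕 f) := hf.comp measurable_pred_snd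

variable [IsProbabilityMeasure P]

lemma IsStationaryHawkes.integrable_compProd (hN : IsStationaryHawkes P η h N)
    (hh : Measurable h) {f : ℝ → ℝ} (hf : Measurable f) (hi : Integrable f) :
    Integrable (fun p : Ω × ℝ => f p.2) (P ⊗ₘ hN.pointProcess.kernel) ∧
      ∫ p, f p.2 ∂(P ⊗ₘ hN.pointProcess.kernel) = meanIntensity P N * ∫ u, f u := by
  have := (hN.hasPredictableIntensity hh).isSFiniteKernel
  have hmap : (P ⊗ₘ hN.pointProcess.kernel).map Prod.snd =
      (∫⁻ ω, N ω (Ioc 0 1) ∂P) • volume := by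
    rw [← hN.bind_eq]
    exact Measure.snd_compProd P hN.pointProcess.kernel
  constructor
  · have h1 : Integrable f ((∫⁻ ω, N ω (Ioc 0 1) ∂P) • volume) :=
      hi.smul_measure hN.finite_mean
    rw [← hmap] at h1
    exact (integrable_map_measure hf.aestronglyMeasurable measurable_snd.aemeasurable).1 h1
  · rw [← integral_map measurable_snd.aemeasurable hf.aestronglyMeasurable, hmap,
      integral_smul_measure, hN.meanIntensity_eq_toReal, smul_eq_mul]

/-- The moving-average representation of a count: up to a constant, it is the compensated integral
of the response function. -/
lemma IsStationaryHawkes.ae_count_eq (hN : IsStationaryHawkes P η h N) (hh : Measurable h)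
    (hsupp : ∀ t < 0, h t = 0) (hμ : ∫⁻ t, (h t : ℝ≥0∞) < 1) (a b : ℝ) :
    (fun ω => (N ω).real (Ioc a b)) =ᵐ[P] fun ω =>
      compIntegral hN.pointProcess.kernel (predIntensity η h hN.pointProcess.measurable)
        (predOfTime _ (responseReal h a b)) ω + η * ∫ u, responseReal h a b u := by
  have H := hN.hasPredictableIntensity hh
  have := H.isSFiniteKernel
  have hfm := measurable_responseReal (h := h) a b
  have hi := (hN.integrable_compProd hh hfm (integrable_responseReal hh hμ a b)).1
  filter_upwards [H.ae_integrable (measurable_predOfTime hfm) hi,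
    Measure.ae_ae_of_ae_prod H.ae_lam_ne_top] with ω h1 h2
  have e0 := hN.pointProcess.lintegral_response_add (η := η) hh hsupp a b ω
  have hm := measurable_response (h := h) a b
  have t1 : ∫ u, responseReal h a b u ∂N ω = (∫⁻ u, response h a b u ∂N ω).toReal :=
    integral_toReal hm.aemeasurable (.of_forall fun u => (response_ne_top hh hμ a b u).lt_top)
  have t2 : ∫ u, responseReal h a b u = (∫⁻ u, response h a b u).toReal :=
    integral_toReal hm.aemeasurable (.of_forall fun u => (response_ne_top hh hμ a b u).lt_top)
  have t3 : ∫ u, responseReal h a b u * (hawkesIntensity η h N u ω).toReal =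
      (∫⁻ u, response h a b u * hawkesIntensity η h N u ω).toReal := by
    simp only [responseReal, ← ENNReal.toReal_mul]
    refine integral_toReal (hm.mul ((hN.pointProcess.measurable_hawkesIntensity hh).comp
      (measurable_prodMk_left (x := ω)))).aemeasurable ?_
    filter_upwards [h2] with u hu
    exact ENNReal.mul_lt_top (response_ne_top hh hμ a b u).lt_top hu.lt_top
  have f1 : ∫⁻ u, response h a b u ∂N ω ≠ ∞ := by
    have h3 : Integrable (responseReal h a b) (N ω) := h1.1
    have := h3.2
    rw [hasFiniteIntegral_iff_ofReal (.of_forall (responseReal_nonneg a b))] at this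
    simpa only [ofReal_responseReal hh hμ] using this.ne
  have f2 : ∫⁻ u, response h a b u ≠ ∞ := by
    have := isFiniteMeasure_resolvent hh hμ
    rw [lintegral_response]
    finiteness
  have f3 : N ω (Ioc a b) + ∫⁻ u, response h a b u * hawkesIntensity η h N u ω ≠ ∞ := by
    rw [← e0]
    finiteness
  have e1 := congrArg ENNReal.toReal e0
  rw [ENNReal.toReal_add f1 (by finiteness), ENNReal.toReal_mul,
    ENNReal.toReal_add (ENNReal.add_ne_top.1 f3).1 (ENNReal.add_ne_top.1 f3).2, ← t1, ← t2,
    ← t3] at e1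
  change (N ω (Ioc a b)).toReal = (∫ u, responseReal h a b u ∂N ω -
    ∫ u, responseReal h a b u * (hawkesIntensity η h N u ω).toReal) + _
  rw [ENNReal.coe_toReal] at e1
  linarith

/-- Counts are square integrable. -/
lemma IsStationaryHawkes.memLp_count (hN : IsStationaryHawkes P η h N) (hh : Measurable h)
    (hsupp : ∀ t < 0, h t = 0) (hμ : ∫⁻ t, (h t : ℝ≥0∞) < 1) (a b : ℝ) :
    MemLp (fun ω => (N ω).real (Ioc a b)) 2 P := by
  have H := hN.hasPredictableIntensity hh
  have hfm := measurable_responseReal (h := h) a b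
  have hi := (hN.integrable_compProd hh hfm (integrable_responseReal hh hμ a b)).1
  have hV := (H.memLp_compIntegral (measurable_predOfTime hfm) hi
    (C := (resolvent h).real univ) fun x => by
      rw [predOfTime, abs_of_nonneg (responseReal_nonneg a b _)]
      exact responseReal_le hh hμ a b _).1
  exact (memLp_congr_ae (hN.ae_count_eq hh hsupp hμ a b)).2 (hV.add (memLp_const _))

lemma IsStationaryHawkes.integral_count (hN : IsStationaryHawkes P η h N) (hh : Measurable h)
    (hsupp : ∀ t < 0, h t = 0) (hμ : ∫⁻ t, (h t : ℝ≥0∞) < 1) (a b : ℝ) :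
    ∫ ω, (N ω).real (Ioc a b) ∂P = η * ∫ u, responseReal h a b u := by
  have H := hN.hasPredictableIntensity hh
  have hfm := measurable_responseReal (h := h) a b
  have hi := (hN.integrable_compProd hh hfm (integrable_responseReal hh hμ a b)).1
  have hV := H.integrable_compIntegral (measurable_predOfTime hfm) hi
  rw [integral_congr_ae (hN.ae_count_eq hh hsupp hμ a b), integral_add hV.1 (integrable_const _),
    hV.2, integral_const]
  simp

/-- The covariance of two counts. -/
lemma IsStationaryHawkes.covariance_count (hN : IsStationaryHawkes P η h N) (hh : Measurable h)
    (hsupp : ∀ t < 0, h t = 0) (hμ : ∫⁻ t, (h t : ℝ≥0∞) < 1) (a b a' b' : ℝ) :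
    cov[fun ω => (N ω).real (Ioc a b), fun ω => (N ω).real (Ioc a' b'); P] =
      meanIntensity P N * ∫ u, responseReal h a b u * responseReal h a' b' u := by
  have H := hN.hasPredictableIntensity hh
  have hfm := measurable_responseReal (h := h) a b
  have hfm' := measurable_responseReal (h := h) a' b'
  have hi := (hN.integrable_compProd hh hfm (integrable_responseReal hh hμ a b)).1
  have hi' := (hN.integrable_compProd hh hfm' (integrable_responseReal hh hμ a' b')).1
  have hC : ∀ c d u, |responseReal h c d u| ≤ (resolvent h).real univ := fun c d u => by
    rw [abs_of_nonneg (responseReal_nonneg c d _)]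
    exact responseReal_le hh hμ c d _
  have e := H.integral_compIntegral_mul (measurable_predOfTime hfm) hi
    (measurable_predOfTime hfm') hi' (fun x => hC a b _) fun x => hC a' b' _
  have hprod : Integrable fun u => responseReal h a b u * responseReal h a' b' u :=
    (integrable_responseReal hh hμ a' b').bdd_mul hfm.aestronglyMeasurable
      (.of_forall fun u => hC a b u)
  have e' := (hN.integrable_compProd hh (hfm.mul hfm') hprod).2
  rw [covariance, hN.integral_count hh hsupp hμ, hN.integral_count hh hsupp hμ]
  refine Eq.trans (integral_congr_ae ?_) (e.trans e')
  filter_upwards [hN.ae_count_eq hh hsupp hμ a b, hN.ae_count_eq hh hsupp hμ a' b'] with ω h1 h2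
  rw [h1, h2]
  ring

/-- The mean intensity of the process. -/
lemma IsStationaryHawkes.meanIntensity_eq (hN : IsStationaryHawkes P η h N) (hh : Measurable h)
    (hsupp : ∀ t < 0, h t = 0) (hμ : ∫⁻ t, (h t : ℝ≥0∞) < 1) :
    meanIntensity P N = (η : ℝ) / (1 - ∫ t : ℝ, (h t : ℝ)) := by
  have e := congrArg ENNReal.toReal (hN.mean_eq hh hsupp)
  have hf := hN.finite_mean
  have hμ' : ∫⁻ t, (h t : ℝ≥0∞) ≠ ∞ := (hμ.trans ENNReal.one_lt_top).ne
  rw [ENNReal.toReal_add (by finiteness) (by finiteness), ENNReal.toReal_mul,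
    ← hN.meanIntensity_eq_toReal, ← integral_coe_eq_toReal hh, ENNReal.coe_toReal] at e
  have hlt : ∫ t, (h t : ℝ) < 1 := by
    rw [integral_coe_eq_toReal hh]
    exact (ENNReal.toReal_lt_toReal hμ' ENNReal.one_ne_top).2 hμ
  rw [eq_div_iff (by linarith)]
  linarith

end SecondOrder

/-! ### Fourier inversion and periodisation -/

section FourierPair

open Real FourierTransform

variable {r F : ℝ → ℝ} {K : ℝ}

lemma integrable_of_quadratic_decay (hF : Continuous F) (hK : ∀ x, |F x| ≤ K * (1 + x ^ 2)⁻¹) :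
    Integrable F :=
  (integrable_inv_one_add_sq.const_mul K).mono' hF.aestronglyMeasurable (.of_forall hK)

/-- Fourier inversion, at the normalisation of the Fourier transform used by Mathlib. -/
lemma integral_exp_smul_eq (hr : Continuous r) (hri : Integrable r) (hFi : Integrable F)
    (hFr : ∀ ω : ℝ, (F ω : ℂ) = ∫ u : ℝ, (r u : ℂ) * Complex.exp (-(Complex.I * ω * u))) (u : ℝ) :
    ∫ v : ℝ, Complex.exp (↑(2 * π * v * u) * Complex.I) • (F (2 * π * v) : ℂ) = r u := by
  have h1 : 𝓕 (fun u => (r u : ℂ)) = fun w => (F (2 * π * w) : ℂ) := by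
    funext w
    rw [Real.fourier_real_eq_integral_exp_smul, hFr]
    refine integral_congr_ae (.of_forall fun v => ?_)
    simp only [smul_eq_mul]
    rw [mul_comm]
    congr 2
    push_cast
    ring
  have h2 : Integrable (𝓕 fun u => (r u : ℂ)) := by
    rw [h1]
    exact (hFi.comp_mul_left' (by positivity)).ofReal
  have h3 := congrFun (Continuous.fourierInv_fourier_eq (Complex.continuous_ofReal.comp hr)
    hri.ofReal h2) u
  rw [Function.comp_apply] at h3
  rw [← h3]
  change _ = 𝓕⁻ (𝓕 fun u => (r u : ℂ)) u
  rw [h1, Real.fourierInv_eq']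
  refine integral_congr_ae (.of_forall fun v => ?_)
  simp only [RCLike.inner_apply, conj_trivial]
  congr 4
  ring

lemma fourier_inversion (hr : Continuous r) (hri : Integrable r) (hFi : Integrable F)
    (hFr : ∀ ω : ℝ, (F ω : ℂ) = ∫ u : ℝ, (r u : ℂ) * Complex.exp (-(Complex.I * ω * u))) (u : ℝ) :
    (r u : ℂ) = (1 / (2 * π) : ℂ) * ∫ ω : ℝ, (F ω : ℂ) * Complex.exp (Complex.I * ω * u) := by
  have h2 := Measure.integral_comp_mul_left
    (fun ω : ℝ => (F ω : ℂ) * Complex.exp (Complex.I * ω * u)) (2 * π)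
  rw [← integral_exp_smul_eq hr hri hFi hFr u]
  have hpi : |(2 * π)⁻¹| = (2 * π)⁻¹ := abs_of_pos (by positivity)
  rw [hpi, Complex.real_smul] at h2
  have : ((1 / (2 * π) : ℂ)) = (((2 * π)⁻¹ : ℝ) : ℂ) := by push_cast; ring
  rw [this, ← h2]
  refine integral_congr_ae (.of_forall fun v => ?_)
  simp only [smul_eq_mul]
  rw [mul_comm]
  congr 2
  push_cast
  ring

lemma summable_translates (hK : ∀ x, |F x| ≤ K * (1 + x ^ 2)⁻¹) (ω : ℝ) :
    Summable fun k : ℤ => F (ω + 2 * k * π) := by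
  have hK0 : 0 ≤ K := by simpa using (abs_nonneg _).trans (hK 0)
  have hs : Summable fun k : ℤ => K * (2 * (1 + ω ^ 2)) * (1 / (k : ℝ) ^ 2) :=
    (Real.summable_one_div_int_pow.2 one_lt_two).mul_left _
  refine Summable.of_norm_bounded_eventually hs ?_
  have h0 : ∀ᶠ k : ℤ in Filter.cofinite, k ≠ 0 := by
    simpa using (Set.finite_singleton (0 : ℤ)).compl_mem_cofinite
  filter_upwards [h0] with k hk
  have hk2 : (0 : ℝ) < (k : ℝ) ^ 2 := by positivity
  refine (hK _).trans ?_
  rw [mul_assoc K]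
  refine mul_le_mul_of_nonneg_left ?_ hK0
  rw [← one_div, mul_one_div, div_le_div_iff₀ (by positivity) hk2, one_mul]
  -- `k² ≤ x² ≤ 2 (ω + x)² + 2 ω²` for `x = 2 k π`
  have h1 : (k : ℝ) ^ 2 ≤ (2 * k * π) ^ 2 := by
    have : (1 : ℝ) ≤ (2 * π) ^ 2 := one_le_pow₀ (by linarith [Real.pi_gt_three])
    calc (k : ℝ) ^ 2 = k ^ 2 * 1 := by ring
      _ ≤ k ^ 2 * (2 * π) ^ 2 := by gcongr
      _ = _ := by ring
  nlinarith [sq_nonneg (2 * ω + 2 * k * π), sq_nonneg (ω * (ω + 2 * k * π))]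

/-- Poisson summation: the periodisation of `F` has the Fourier series with coefficients the values
of `r` at the integers. -/
lemma hasSum_periodisation (hr : Continuous r) (hri : Integrable r) (hF : Continuous F)
    (hK : ∀ x, |F x| ≤ K * (1 + x ^ 2)⁻¹)
    (hFr : ∀ ω : ℝ, (F ω : ℂ) = ∫ u : ℝ, (r u : ℂ) * Complex.exp (-(Complex.I * ω * u)))
    (hs : Summable fun n : ℤ => r n) (ω : ℝ) :
    HasSum (fun n : ℤ => (r n : ℂ) * Complex.exp (-(Complex.I * ω * n)))
      ((∑' k : ℤ, F (ω + 2 * k * π) : ℝ) : ℂ) := by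
  have hFi := integrable_of_quadratic_decay hF hK
  have hK0 : 0 ≤ K := by simpa using (abs_nonneg _).trans (hK 0)
  set g : ℝ → ℂ := fun x => (F (2 * π * x) : ℂ) with hg
  have hgc : Continuous g := by fun_prop
  have hgO : g =O[Filter.cocompact ℝ] fun x : ℝ => |x| ^ (-2 : ℝ) := by
    refine Asymptotics.IsBigO.of_bound K ?_
    have h0 : ∀ᶠ x : ℝ in Filter.cocompact ℝ, x ≠ 0 := by
      simpa using (isCompact_singleton (x := (0 : ℝ))).compl_mem_cocompact
    filter_upwards [h0] with x hx
    have hx2 : 0 < x ^ 2 := by positivity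
    simp only [hg, Complex.norm_real]
    refine (hK _).trans ?_
    gcongr
    rw [Real.norm_of_nonneg (by positivity), Real.rpow_neg (abs_nonneg x), Real.rpow_two, sq_abs]
    gcongr
    have : (1 : ℝ) ≤ (2 * π) ^ 2 := one_le_pow₀ (by linarith [Real.pi_gt_three])
    nlinarith
  have hFg : ∀ n : ℤ, 𝓕 g n = r (-n) := by
    intro n
    have := integral_exp_smul_eq hr hri hFi hFr (-n)
    rw [Real.fourier_real_eq_integral_exp_smul, ← this]
    congr 1 with v
    congr 4
    ring
  have hsn : Summable fun n : ℤ => r (-n) := by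
    simpa [Function.comp_def] using (Equiv.neg ℤ).summable_iff.2 hs
  have hsum : Summable fun n : ℤ => 𝓕 g n := by
    simp only [hFg]
    exact Complex.summable_ofReal.2 hsn
  have hP := Real.tsum_eq_tsum_fourier_of_rpow_decay_of_summable hgc one_lt_two hgO hsum
    (ω / (2 * π))
  have e1 : ∑' n : ℤ, g (ω / (2 * π) + n) = ((∑' k : ℤ, F (ω + 2 * k * π) : ℝ) : ℂ) := by
    rw [Complex.ofReal_tsum]
    refine tsum_congr fun n => ?_
    simp only [hg]
    congr 2
    field_simp
  have hsc : Summable fun n : ℤ => (r n : ℂ) * Complex.exp (-(Complex.I * ω * n)) := by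
    refine Summable.of_norm_bounded hs.norm fun n => ?_
    rw [norm_mul, show -(Complex.I * ω * n) = ((-(ω * n) : ℝ) : ℂ) * Complex.I by push_cast; ring,
      Complex.norm_exp_ofReal_mul_I, mul_one, Complex.norm_real]
  have e2 : ∑' n : ℤ, 𝓕 g n * fourier n ((ω / (2 * π) : ℝ) : UnitAddCircle) =
      ∑' n : ℤ, (r n : ℂ) * Complex.exp (-(Complex.I * ω * n)) := by
    rw [← (Equiv.neg ℤ).tsum_eq]
    refine tsum_congr fun n => ?_
    rw [Equiv.neg_apply, hFg, fourier_coe_apply]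
    push_cast
    rw [neg_neg]
    congr 2
    field_simp
  rw [← e1, hP, e2]
  exact hsc.hasSum

lemma integral_exp_int (k : ℤ) :
    ∫ ω in (-π)..π, Complex.exp (Complex.I * ω * k) = if k = 0 then (2 * π : ℂ) else 0 := by
  split_ifs with hk
  · simp [hk]
    ring
  · have hc : Complex.I * k ≠ 0 := by simp [hk]
    have : ∀ ω : ℝ, Complex.exp (Complex.I * ω * k) = Complex.exp (Complex.I * k * ω) := by
      intro ω; ring_nf
    simp only [this]
    rw [integral_exp_mul_complex hc, div_eq_zero_iff]
    left
    rw [sub_eq_zero, Complex.exp_eq_exp_iff_exists_int]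
    exact ⟨k, by push_cast; ring⟩

/-- The coefficients of an absolutely convergent Fourier series are recovered by integration over a
period. -/
lemma fourier_series_inversion {c : ℤ → ℝ} (hs : Summable c) {f : ℝ → ℝ}
    (hf : ∀ ω : ℝ, HasSum (fun n : ℤ => (c n : ℂ) * Complex.exp (-(Complex.I * ω * n))) (f ω : ℂ)) :
    Continuous f ∧ ∀ u : ℤ, (c u : ℂ) =
      (1 / (2 * π) : ℂ) * ∫ ω in (-π)..π, (f ω : ℂ) * Complex.exp (Complex.I * ω * u) := by
  have hnorm : ∀ (n : ℤ) (ω : ℝ), ‖(c n : ℂ) * Complex.exp (-(Complex.I * ω * n))‖ = ‖c n‖ := by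
    intro n ω
    rw [norm_mul, show -(Complex.I * ω * n) = ((-(ω * n) : ℝ) : ℂ) * Complex.I by push_cast; ring,
      Complex.norm_exp_ofReal_mul_I, mul_one, Complex.norm_real]
  constructor
  · have h1 : Continuous fun ω : ℝ =>
        ∑' n : ℤ, (c n : ℂ) * Complex.exp (-(Complex.I * ω * n)) :=
      continuous_tsum (fun n => by fun_prop) hs.norm fun n ω => (hnorm n ω).le
    have h2 : f = fun ω : ℝ => (∑' n : ℤ, (c n : ℂ) * Complex.exp (-(Complex.I * ω * n))).re := by
      funext ω
      rw [(hf ω).tsum_eq, Complex.ofReal_re]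
    rw [h2]
    exact Complex.continuous_re.comp h1
  · intro u
    have h1 : HasSum (fun n : ℤ => ∫ ω in (-π)..π,
        ((c n : ℂ) * Complex.exp (-(Complex.I * ω * n))) * Complex.exp (Complex.I * ω * u))
        (∫ ω in (-π)..π, (f ω : ℂ) * Complex.exp (Complex.I * ω * u)) := by
      refine intervalIntegral.hasSum_integral_of_dominated_convergence (fun n _ => ‖c n‖)
        (fun n => ?_) (fun n => .of_forall fun ω _ => ?_) (.of_forall fun _ _ => hs.norm)
        intervalIntegrable_const (.of_forall fun ω _ => (hf ω).mul_right _)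
      · exact Continuous.aestronglyMeasurable (by fun_prop)
      · rw [norm_mul, hnorm, show Complex.I * ω * u = ((ω * u : ℝ) : ℂ) * Complex.I by
          push_cast; ring, Complex.norm_exp_ofReal_mul_I, mul_one]
    have h2 : ∀ n : ℤ, ∫ ω in (-π)..π,
        ((c n : ℂ) * Complex.exp (-(Complex.I * ω * n))) * Complex.exp (Complex.I * ω * u) =
        if n = u then (c u : ℂ) * (2 * π) else 0 := by
      intro n
      have : ∀ ω : ℝ, ((c n : ℂ) * Complex.exp (-(Complex.I * ω * n))) *
          Complex.exp (Complex.I * ω * u) =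
          (c n : ℂ) * Complex.exp (Complex.I * ω * (u - n : ℤ)) := by
        intro ω
        rw [mul_assoc, ← Complex.exp_add]
        congr 2
        push_cast
        ring
      simp only [this]
      rw [intervalIntegral.integral_const_mul, integral_exp_int]
      by_cases h : n = u
      · simp [h]
      · simp [h, sub_eq_zero, Ne.symm h]
    simp only [h2] at h1
    have h3 := h1.unique (hasSum_ite_eq u ((c u : ℂ) * (2 * π)))
    rw [h3]
    have : (π : ℂ) ≠ 0 := by exact_mod_cast Real.pi_ne_zero
    field_simp

end FourierPair

/-! ### The Fourier transform of the response function -/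

section Transform

open Real ComplexConjugate

variable {F G : ℝ → ℝ}

lemma integrable_mul_exp (hF : Integrable F) (ω : ℝ) :
    Integrable fun t : ℝ => (F t : ℂ) * Complex.exp (-(Complex.I * ω * t)) := by
  refine hF.ofReal.mul_bdd (c := 1) (Continuous.aestronglyMeasurable (by fun_prop))
    (.of_forall fun t => ?_)
  rw [show -(Complex.I * ω * t) = ((-(ω * t) : ℝ) : ℂ) * Complex.I by push_cast; ring,
    Complex.norm_exp_ofReal_mul_I]

lemma norm_fourierTilde_le (F : ℝ → ℝ) (ω : ℝ) : ‖fourierTilde F ω‖ ≤ ∫ t, |F t| := by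
  refine (norm_integral_le_integral_norm _).trans (le_of_eq ?_)
  refine integral_congr_ae (.of_forall fun t => ?_)
  simp only [norm_mul, Complex.norm_real, Real.norm_eq_abs]
  rw [show -(Complex.I * ω * t) = ((-(ω * t) : ℝ) : ℂ) * Complex.I by push_cast; ring,
    Complex.norm_exp_ofReal_mul_I, mul_one]

lemma continuous_fourierTilde (hF : Integrable F) : Continuous (fourierTilde F) := by
  refine continuous_of_dominated (bound := fun t => |F t|)
    (fun ω => (integrable_mul_exp hF ω).aestronglyMeasurable) (fun ω => .of_forall fun t => ?_)
    hF.abs (.of_forall fun t => by fun_prop)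
  rw [norm_mul, show -(Complex.I * ω * t) = ((-(ω * t) : ℝ) : ℂ) * Complex.I by push_cast; ring,
    Complex.norm_exp_ofReal_mul_I, mul_one, Complex.norm_real, Real.norm_eq_abs]

lemma integrable_convolution_real (hF : Integrable F) (hG : Integrable G) :
    Integrable fun τ => ∫ s, F s * G (τ - s) :=
  hF.integrable_convolution (ContinuousLinearMap.mul ℝ ℝ) hG

lemma fourierTilde_convolution (hF : Integrable F) (hG : Integrable G) (ω : ℝ) :
    fourierTilde (fun τ => ∫ s, F s * G (τ - s)) ω = fourierTilde F ω * fourierTilde G ω := by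
  have h := integral_convolution (ContinuousLinearMap.mul ℝ ℂ) (integrable_mul_exp hF ω)
    (integrable_mul_exp hG ω)
  rw [ContinuousLinearMap.mul_apply'] at h
  unfold fourierTilde
  rw [← h]
  refine integral_congr_ae (.of_forall fun τ => ?_)
  simp only [convolution, ContinuousLinearMap.mul_apply']
  rw [← integral_complex_ofReal, ← integral_mul_const]
  refine integral_congr_ae (.of_forall fun s => ?_)
  simp only
  have : Complex.exp (-(Complex.I * ω * τ)) =
      Complex.exp (-(Complex.I * ω * s)) * Complex.exp (-(Complex.I * ω * (τ - s : ℝ))) := by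
    rw [← Complex.exp_add]
    congr 1
    push_cast
    ring
  rw [this]
  push_cast
  ring

lemma fourierTilde_comp_neg (F : ℝ → ℝ) (ω : ℝ) :
    fourierTilde (fun t => F (-t)) ω = conj (fourierTilde F ω) := by
  unfold fourierTilde
  rw [← integral_conj, ← integral_neg_eq_self]
  refine integral_congr_ae (.of_forall fun t => ?_)
  simp [← Complex.exp_conj]

lemma norm_sq_fourierTilde_indicator {Δ : ℝ} (hΔ : 0 < Δ) (ω : ℝ) :
    ‖fourierTilde ((Ioc 0 Δ).indicator 1) ω‖ ^ 2 = Δ ^ 2 * sinc (ω * Δ / 2) ^ 2 := by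
  have e : fourierTilde ((Ioc 0 Δ).indicator 1) ω =
      ∫ t in (0 : ℝ)..Δ, Complex.exp (-(Complex.I * ω) * t) := by
    rw [intervalIntegral.integral_of_le hΔ.le, ← integral_indicator measurableSet_Ioc]
    refine integral_congr_ae (.of_forall fun t => ?_)
    by_cases ht : t ∈ Ioc 0 Δ <;> simp [ht]
  rw [e]
  by_cases hω : ω = 0
  · simp [hω]
  · have hc : -(Complex.I * ω) ≠ 0 := by simp [hω]
    rw [integral_exp_mul_complex hc]
    have h1 : Complex.exp (-(Complex.I * ω) * Δ) - Complex.exp (-(Complex.I * ω) * (0 : ℝ)) =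
        Complex.exp (Complex.I * (-(ω * Δ) : ℝ)) - 1 := by
      push_cast
      rw [mul_zero, Complex.exp_zero]
      congr 2
      ring
    rw [h1, norm_div, Complex.norm_exp_I_mul_ofReal_sub_one, sinc_of_ne_zero (by positivity)]
    simp only [norm_neg, norm_mul, Complex.norm_I, Complex.norm_real, one_mul, neg_div, sin_neg,
      mul_neg, div_pow, mul_pow, Real.norm_eq_abs, sq_abs]
    field_simp

lemma norm_fourierTilde_coe_le (h : ℝ → ℝ≥0) (ω : ℝ) :
    ‖fourierTilde (fun t => (h t : ℝ)) ω‖ ≤ ∫ t, (h t : ℝ) := by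
  have := norm_fourierTilde_le (fun t => (h t : ℝ)) ω
  simpa using this

lemma one_sub_le_norm (h : ℝ → ℝ≥0) (ω : ℝ) :
    1 - ∫ t, (h t : ℝ) ≤ ‖1 - fourierTilde (fun t => (h t : ℝ)) ω‖ := by
  have h1 := norm_sub_norm_le (1 : ℂ) (fourierTilde (fun t => (h t : ℝ)) ω)
  have h2 := norm_fourierTilde_coe_le h ω
  rw [norm_one] at h1
  linarith

end Transform

section ResponseTransform

open Real ComplexConjugate

variable {h : ℝ → ℝ≥0} (hh : Measurable h) (hμ : ∫⁻ t, (h t : ℝ≥0∞) < 1)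
include hh hμ

lemma integrable_coe_of_lintegral_lt_one : Integrable fun t => (h t : ℝ) := by
  refine ⟨by fun_prop, ?_⟩
  simpa [hasFiniteIntegral_iff_enorm] using hμ.trans ENNReal.one_lt_top

lemma integral_coe_lt_one : ∫ t, (h t : ℝ) < 1 := by
  rw [integral_coe_eq_toReal hh]
  exact (ENNReal.toReal_lt_toReal (hμ.trans ENNReal.one_lt_top).ne ENNReal.one_ne_top).2 hμ

lemma responseReal_eq (a b u : ℝ) :
    responseReal h a b u = (Ioc a b).indicator 1 u + ∫ s, (h (-s) : ℝ) * responseReal h a b (u - s)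
      := by
  have e := congrArg ENNReal.toReal (response_eq hh a b u)
  have hne := response_ne_top hh hμ a b u
  rw [response_eq hh a b u] at hne
  rw [ENNReal.toReal_add (ENNReal.add_ne_top.1 hne).1 (ENNReal.add_ne_top.1 hne).2] at e
  have e1 : ((Ioc a b).indicator (1 : ℝ → ℝ≥0∞) u).toReal = (Ioc a b).indicator 1 u := by
    by_cases hu : u ∈ Ioc a b <;> simp [hu]
  have e2 : (∫⁻ w, h w * response h a b (u + w)).toReal =
      ∫ w, (h w : ℝ) * responseReal h a b (u + w) := by
    rw [← integral_toReal]
    · simp [responseReal]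
    · have := measurable_response (h := h) a b
      fun_prop
    · exact .of_forall fun w => ENNReal.mul_lt_top ENNReal.coe_lt_top
        (response_ne_top hh hμ a b _).lt_top
  rw [e1, e2] at e
  rw [responseReal, e, ← integral_neg_eq_self]
  simp only [sub_eq_add_neg, responseReal]

/-- The transfer function: `f̂ = φ̂ / conj (1 - ĥ)`, in modulus. -/
lemma norm_sq_fourierTilde_responseReal {Δ : ℝ} (hΔ : 0 < Δ) (ω : ℝ) :
    ‖fourierTilde (responseReal h 0 Δ) ω‖ ^ 2 = Δ ^ 2 * sinc (ω * Δ / 2) ^ 2 *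
      (‖1 - fourierTilde (fun t => (h t : ℝ)) ω‖ ^ 2)⁻¹ := by
  have hf := integrable_responseReal hh hμ 0 Δ
  have hi := integrable_coe_of_lintegral_lt_one hh hμ
  have hφ : Integrable ((Ioc 0 Δ).indicator (1 : ℝ → ℝ)) :=
    (integrable_indicator_iff measurableSet_Ioc).2 (integrableOn_const (by simp))
  have e : fourierTilde (responseReal h 0 Δ) ω = fourierTilde ((Ioc 0 Δ).indicator 1) ω +
      conj (fourierTilde (fun t => (h t : ℝ)) ω) * fourierTilde (responseReal h 0 Δ) ω := by
    rw [← fourierTilde_comp_neg, ← fourierTilde_convolution hi.comp_neg hf]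
    have hconv := integrable_convolution_real hi.comp_neg hf
    unfold fourierTilde at *
    rw [← integral_add (integrable_mul_exp hφ ω) (integrable_mul_exp hconv ω)]
    refine integral_congr_ae (.of_forall fun u => ?_)
    simp only
    rw [responseReal_eq hh hμ 0 Δ u]
    push_cast
    ring
  have e2 : fourierTilde ((Ioc 0 Δ).indicator 1) ω =
      conj (1 - fourierTilde (fun t => (h t : ℝ)) ω) * fourierTilde (responseReal h 0 Δ) ω := by
    rw [map_sub, map_one]
    linear_combination -e
  have hpos : 0 < ‖1 - fourierTilde (fun t => (h t : ℝ)) ω‖ :=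
    lt_of_lt_of_le (by linarith [integral_coe_lt_one hh hμ]) (one_sub_le_norm h ω)
  rw [← norm_sq_fourierTilde_indicator hΔ, e2, norm_mul, RCLike.norm_conj, mul_pow]
  field_simp

/-- The response function is a difference of two monotone functions, so it is continuous outside a
countable set. -/
lemma ae_continuousAt_responseReal (a b : ℝ) : ∀ᵐ u, ContinuousAt (responseReal h a b) u := by
  have := isFiniteMeasure_resolvent hh hμ
  have hmono : ∀ c, Antitone fun u => (resolvent h).real (Iic (c - u)) := fun c u v huv =>
    measureReal_mono (Iic_subset_Iic.2 (by linarith))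
  rcases le_total a b with hab | hab
  · have e : responseReal h a b =
        fun u => (resolvent h).real (Iic (b - u)) - (resolvent h).real (Iic (a - u)) := by
      funext u
      have hsub : Iic (a - u) ⊆ Iic (b - u) := Iic_subset_Iic.2 (by linarith)
      have hset : Iic (b - u) \ Iic (a - u) = Ioc (a - u) (b - u) := by
        ext x
        simp [and_comm]
      rw [← measureReal_sdiff hsub measurableSet_Iic, hset]
      rfl
    rw [e]
    filter_upwards [(hmono a).countable_not_continuousAt.ae_notMem volume,
      (hmono b).countable_not_continuousAt.ae_notMem volume] with u h1 h2
    simp only [not_not] at h1 h2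
    exact h2.sub h1
  · have e : responseReal h a b = fun _ => 0 := by
      funext u
      rw [responseReal, response, Ioc_eq_empty_of_le (by linarith)]
      simp
    rw [e]
    exact .of_forall fun u => continuousAt_const

lemma continuous_autocorrelation (a b : ℝ) :
    Continuous fun τ => ∫ s, responseReal h a b s * responseReal h a b (s - τ) := by
  refine continuous_iff_continuousAt.2 fun τ₀ => ?_
  have hfm := measurable_responseReal (h := h) a b
  refine continuousAt_of_dominated
    (bound := fun s => responseReal h a b s * (resolvent h).real univ)
    (.of_forall fun τ => (by fun_prop : Measurable _).aestronglyMeasurable)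
    (.of_forall fun τ => .of_forall fun s => ?_)
    ((integrable_responseReal hh hμ a b).mul_const _) ?_
  · rw [Real.norm_of_nonneg (mul_nonneg (responseReal_nonneg _ _ _) (responseReal_nonneg _ _ _))]
    exact mul_le_mul_of_nonneg_left (responseReal_le hh hμ _ _ _) (responseReal_nonneg _ _ _)
  · have hq : Measure.QuasiMeasurePreserving (fun s : ℝ => s - τ₀) :=
      (measurePreserving_sub_right volume τ₀).quasiMeasurePreserving
    filter_upwards [hq.ae (ae_continuousAt_responseReal hh hμ a b)] with s hs
    exact continuousAt_const.mul
      (ContinuousAt.comp (f := fun τ => s - τ) hs (by fun_prop))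

lemma fourierTilde_autocorrelation (a b ω : ℝ) :
    Integrable (fun τ => ∫ s, responseReal h a b s * responseReal h a b (s - τ)) ∧
    fourierTilde (fun τ => ∫ s, responseReal h a b s * responseReal h a b (s - τ)) ω =
      ((‖fourierTilde (responseReal h a b) ω‖ ^ 2 : ℝ) : ℂ) := by
  have hf := integrable_responseReal hh hμ a b
  have e : (fun τ => ∫ s, responseReal h a b s * responseReal h a b (s - τ)) =
      fun τ => ∫ s, responseReal h a b s * (fun x => responseReal h a b (-x)) (τ - s) := by
    funext τ
    simp only [neg_sub]
  rw [e]
  refine ⟨integrable_convolution_real hf hf.comp_neg, ?_⟩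
  rw [fourierTilde_convolution hf hf.comp_neg, fourierTilde_comp_neg, RCLike.mul_conj]
  norm_cast

/-- The autocorrelation of the response function of `(0, Δ]` is summable along the lattice `Δ ℤ`,
since the translates of the interval by the lattice partition the line. -/
lemma summable_autocorrelation {Δ : ℝ} (hΔ : 0 < Δ) :
    Summable fun n : ℤ => ∫ s, responseReal h 0 Δ s * responseReal h 0 Δ (s - n * Δ) := by
  have := isFiniteMeasure_resolvent hh hμ
  have hm := measurable_response (h := h) 0 Δ
  have hsum : ∀ s, ∑' n : ℤ, response h 0 Δ (s - n * Δ) = resolvent h univ := by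
    intro s
    rw [← iUnion_Ioc_add_zsmul hΔ (-s),
      measure_iUnion (pairwise_disjoint_Ioc_add_zsmul (-s) Δ) fun _ => measurableSet_Ioc]
    refine tsum_congr fun n => ?_
    rw [response]
    congr 2 <;> simp only [zsmul_eq_mul] <;> push_cast <;> ring
  have hfin : ∑' n : ℤ, ∫⁻ s, response h 0 Δ s * response h 0 Δ (s - n * Δ) ≠ ∞ := by
    rw [← lintegral_tsum fun n => by fun_prop]
    simp only [ENNReal.tsum_mul_left, hsum]
    rw [lintegral_mul_const _ hm, lintegral_response]
    finiteness
  refine (ENNReal.summable_toReal hfin).congr fun n => ?_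
  rw [← integral_toReal (by fun_prop) (.of_forall fun s => ENNReal.mul_lt_top
    (response_ne_top hh hμ _ _ _).lt_top (response_ne_top hh hμ _ _ _).lt_top)]
  simp [responseReal]

lemma continuous_fc (m Δ : ℝ) : Continuous (fc m Δ h) := by
  have hc := continuous_fourierTilde (integrable_coe_of_lintegral_lt_one hh hμ)
  unfold fc
  refine Continuous.mul (by fun_prop) (Continuous.inv₀ (by fun_prop) fun ω => ?_)
  have hpos : 0 < ‖1 - fourierTilde (fun t => (h t : ℝ)) (ω / Δ)‖ :=
    lt_of_lt_of_le (by linarith [integral_coe_lt_one hh hμ]) (one_sub_le_norm h _)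
  positivity

lemma abs_fc_le {m Δ : ℝ} (hm : 0 ≤ m) (hΔ : 0 < Δ) (ω : ℝ) :
    |fc m Δ h ω| ≤ m * Δ * 5 * ((1 - ∫ t, (h t : ℝ)) ^ 2)⁻¹ * (1 + ω ^ 2)⁻¹ := by
  have hlt := integral_coe_lt_one hh hμ
  have h1 : sinc (ω / 2) ^ 2 ≤ 5 * (1 + ω ^ 2)⁻¹ := by
    rw [← div_eq_mul_inv, le_div_iff₀ (by positivity)]
    have h2 : sinc (ω / 2) ^ 2 ≤ 1 := (sq_le_one_iff_abs_le_one _).2 (abs_sinc_le_one _)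
    have h3 : sinc (ω / 2) ^ 2 * (ω / 2) ^ 2 ≤ 1 := by
      by_cases hω : ω / 2 = 0
      · simp [hω]
      · rw [sinc_of_ne_zero hω, ← mul_pow, div_mul_cancel₀ _ hω]
        exact sin_sq_le_one _
    nlinarith
  have h4 : (‖1 - fourierTilde (fun t => (h t : ℝ)) (ω / Δ)‖ ^ 2)⁻¹ ≤
      ((1 - ∫ t, (h t : ℝ)) ^ 2)⁻¹ := by
    have h5 := one_sub_le_norm h (ω / Δ)
    have h6 : 0 < 1 - ∫ t, (h t : ℝ) := by linarith
    gcongr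
  unfold fc
  rw [abs_of_nonneg (by positivity)]
  calc m * Δ * sinc (ω / 2) ^ 2 * (‖1 - fourierTilde (fun t => (h t : ℝ)) (ω / Δ)‖ ^ 2)⁻¹
      ≤ m * Δ * (5 * (1 + ω ^ 2)⁻¹) * ((1 - ∫ t, (h t : ℝ)) ^ 2)⁻¹ := by gcongr
    _ = _ := by ring

end ResponseTransform

/-! ### The spectral density of the bin counts -/

section BinCounts

variable {Ω : Type*} {mΩ : MeasurableSpace Ω} {P : Measure Ω} {η : ℝ≥0}
  {h : ℝ → ℝ≥0} {N : Ω → Measure ℝ}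

lemma meanIntensity_nonneg : 0 ≤ meanIntensity P N := integral_nonneg fun _ => measureReal_nonneg

lemma autocov_binCountSeq (Δ : ℝ) (n : ℤ) :
    autocov P (binCountSeq N Δ) n = autocov P (binCount N Δ) n := by
  change cov[binCount N Δ ((0 : ℤ) : ℝ), binCount N Δ (n : ℝ); P] = _
  rw [Int.cast_zero]
  rfl

lemma responseReal_bin (Δ t s : ℝ) :
    responseReal h (t * Δ) ((t + 1) * Δ) s = responseReal h 0 Δ (s - t * Δ) := by
  have := response_add (h := h) 0 Δ (s - t * Δ) (t * Δ)
  rw [responseReal, responseReal, ← this]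
  congr 2 <;> ring

variable [IsProbabilityMeasure P]

lemma IsStationaryHawkes.covariance_binCount (hN : IsStationaryHawkes P η h N) (hh : Measurable h)
    (hsupp : ∀ t < 0, h t = 0) (hμ : ∫⁻ t, (h t : ℝ≥0∞) < 1) (Δ s u : ℝ) :
    cov[binCount N Δ s, binCount N Δ (s + u); P] =
      meanIntensity P N * ∫ x, responseReal h 0 Δ x * responseReal h 0 Δ (x - u * Δ) := by
  unfold binCount
  rw [hN.covariance_count hh hsupp hμ]
  simp only [responseReal_bin]
  rw [← integral_add_right_eq_self _ (s * Δ)]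
  congr 2 with x
  congr 2 <;> ring

lemma IsStationaryHawkes.isWeaklyStationary_binCount (hN : IsStationaryHawkes P η h N)
    (hh : Measurable h) (hsupp : ∀ t < 0, h t = 0) (hμ : ∫⁻ t, (h t : ℝ≥0∞) < 1) {Δ : ℝ}
    (hΔ : 0 < Δ) : IsWeaklyStationary P (binCount N Δ) where
  memLp t := hN.memLp_count hh hsupp hμ _ _
  mean t := by
    unfold binCount
    rw [hN.integral_count hh hsupp hμ, hN.integral_count hh hsupp hμ,
      integral_responseReal hh hμ (by nlinarith), integral_responseReal hh hμ (by nlinarith)]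
    ring
  cov s u := by
    rw [hN.covariance_binCount hh hsupp hμ]
    have := hN.covariance_binCount hh hsupp hμ Δ 0 u
    rw [zero_add] at this
    rw [this]

lemma IsStationaryHawkes.autocov_binCount (hN : IsStationaryHawkes P η h N) (hh : Measurable h)
    (hsupp : ∀ t < 0, h t = 0) (hμ : ∫⁻ t, (h t : ℝ≥0∞) < 1) (Δ : ℝ) :
    autocov P (binCount N Δ) = fun u =>
      meanIntensity P N * ∫ x, responseReal h 0 Δ x * responseReal h 0 Δ (x - u * Δ) := by
  funext u
  have := hN.covariance_binCount hh hsupp hμ Δ 0 u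
  rwa [zero_add] at this

lemma IsStationaryHawkes.fc_eq_integral (hN : IsStationaryHawkes P η h N) (hh : Measurable h)
    (hsupp : ∀ t < 0, h t = 0) (hμ : ∫⁻ t, (h t : ℝ≥0∞) < 1) {Δ : ℝ} (hΔ : 0 < Δ) (ω : ℝ) :
    (fc (meanIntensity P N) Δ h ω : ℂ) =
      ∫ u : ℝ, (autocov P (binCount N Δ) u : ℂ) * Complex.exp (-(Complex.I * ω * u)) := by
  set A : ℝ → ℝ := fun τ => ∫ s, responseReal h 0 Δ s * responseReal h 0 Δ (s - τ) with hA
  have e := (fourierTilde_autocorrelation hh hμ 0 Δ (ω / Δ)).2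
  rw [norm_sq_fourierTilde_responseReal hh hμ hΔ, fourierTilde] at e
  have e2 := Measure.integral_comp_mul_right (fun τ : ℝ => (A τ : ℂ) *
    Complex.exp (-(Complex.I * (ω / Δ : ℝ) * τ))) Δ
  rw [e, abs_of_pos (by positivity), Complex.real_smul] at e2
  have e3 : ∫ u : ℝ, (autocov P (binCount N Δ) u : ℂ) * Complex.exp (-(Complex.I * ω * u)) =
      (meanIntensity P N : ℂ) * ∫ u : ℝ, (A (u * Δ) : ℂ) *
        Complex.exp (-(Complex.I * (ω / Δ : ℝ) * (u * Δ : ℝ))) := by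
    rw [← integral_const_mul, hN.autocov_binCount hh hsupp hμ]
    refine integral_congr_ae (.of_forall fun u => ?_)
    simp only [hA]
    have hΔ' : (Δ : ℂ) ≠ 0 := by exact_mod_cast hΔ.ne'
    rw [show -(Complex.I * (ω / Δ : ℝ) * (u * Δ : ℝ)) = -(Complex.I * ω * u) by
      push_cast; field_simp]
    push_cast
    ring
  rw [e3, e2, fc, div_mul_cancel₀ _ hΔ.ne']
  have hΔ' : (Δ : ℂ) ≠ 0 := by exact_mod_cast hΔ.ne'
  push_cast
  field_simp

lemma IsStationaryHawkes.continuous_autocov (hN : IsStationaryHawkes P η h N) (hh : Measurable h)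
    (hsupp : ∀ t < 0, h t = 0) (hμ : ∫⁻ t, (h t : ℝ≥0∞) < 1) (Δ : ℝ) :
    Continuous (autocov P (binCount N Δ)) := by
  rw [hN.autocov_binCount hh hsupp hμ]
  exact continuous_const.mul ((continuous_autocorrelation hh hμ 0 Δ).comp (by fun_prop))

lemma IsStationaryHawkes.integrable_autocov (hN : IsStationaryHawkes P η h N) (hh : Measurable h)
    (hsupp : ∀ t < 0, h t = 0) (hμ : ∫⁻ t, (h t : ℝ≥0∞) < 1) {Δ : ℝ} (hΔ : 0 < Δ) :
    Integrable (autocov P (binCount N Δ)) := by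
  rw [hN.autocov_binCount hh hsupp hμ]
  exact ((fourierTilde_autocorrelation hh hμ 0 Δ 0).1.comp_mul_right' hΔ.ne').const_mul _

lemma IsStationaryHawkes.summable_autocov (hN : IsStationaryHawkes P η h N) (hh : Measurable h)
    (hsupp : ∀ t < 0, h t = 0) (hμ : ∫⁻ t, (h t : ℝ≥0∞) < 1) {Δ : ℝ} (hΔ : 0 < Δ) :
    Summable fun n : ℤ => autocov P (binCount N Δ) n := by
  rw [hN.autocov_binCount hh hsupp hμ]
  exact (summable_autocorrelation hh hμ hΔ).mul_left _

end BinCounts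

end HawkesSpectral

end

theorem mainTheorem7 {Ω : Type*} [MeasurableSpace Ω] (P : Measure Ω) [IsProbabilityMeasure P]
    (η : ℝ≥0) (hη : 0 < η)
    (h : ℝ → ℝ≥0) (hmeas : Measurable h) (hsupp : ∀ t < 0, h t = 0)
    (hμ : ∫⁻ t : ℝ, (h t : ℝ≥0∞) < 1)
    (N : Ω → Measure ℝ) (hN : HawkesSpectral.IsStationaryHawkes P η h N)
    (Δ : ℝ) (hΔ : 0 < Δ) :
    HawkesSpectral.meanIntensity P N = (η : ℝ) / (1 - ∫ t : ℝ, (h t : ℝ)) ∧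
    HawkesSpectral.IsSpectralDensityCont P (HawkesSpectral.binCount N Δ)
      (HawkesSpectral.fc (HawkesSpectral.meanIntensity P N) Δ h) ∧
    (∀ ω : ℝ, Summable fun k : ℤ =>
      HawkesSpectral.fc (HawkesSpectral.meanIntensity P N) Δ h (ω + 2 * k * Real.pi)) ∧
    HawkesSpectral.IsSpectralDensityDisc P (HawkesSpectral.binCountSeq N Δ)
      (fun ω => ∑' k : ℤ,
        HawkesSpectral.fc (HawkesSpectral.meanIntensity P N) Δ h (ω + 2 * k * Real.pi)) := by
  have hr := hN.continuous_autocov hmeas hsupp hμ Δ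
  have hri := hN.integrable_autocov hmeas hsupp hμ hΔ
  have hFr := hN.fc_eq_integral hmeas hsupp hμ hΔ
  have hF := HawkesSpectral.continuous_fc hmeas hμ (HawkesSpectral.meanIntensity P N) Δ
  have hK := HawkesSpectral.abs_fc_le hmeas hμ (HawkesSpectral.meanIntensity_nonneg (P := P) (N := N)) hΔ
  have hFi := HawkesSpectral.integrable_of_quadratic_decay hF hK
  have hs := hN.summable_autocov hmeas hsupp hμ hΔ
  have hws := hN.isWeaklyStationary_binCount hmeas hsupp hμ hΔ
  have hfd := HawkesSpectral.hasSum_periodisation hr hri hF hK hFr hs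
  obtain ⟨hfc, hinv⟩ := HawkesSpectral.fourier_series_inversion hs hfd
  refine ⟨hN.meanIntensity_eq hmeas hsupp hμ,
    ⟨hws, hri, hFr, hFi, HawkesSpectral.fourier_inversion hr hri hFi hFr⟩,
    HawkesSpectral.summable_translates hK, ⟨⟨fun k => hws.memLp k, fun k => ?_, fun k l => ?_⟩, fun ω => ?_,
      hfc.intervalIntegrable _ _, fun u => ?_⟩⟩
  · have e := hws.mean k
    rw [← Int.cast_zero] at e
    exact e
  · have e := hws.cov k l
    rw [← Int.cast_zero, ← Int.cast_add] at e
    exact e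
  · simpa only [HawkesSpectral.autocov_binCountSeq] using hfd ω
  · simpa only [HawkesSpectral.autocov_binCountSeq] using hinv u
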